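/- Let $\phi:\mathbb R\to\mathbb R$ be a non-constant $C^1$ function for which there is $B>0$ such that $|\phi'|\le B$ and $\phi'$ is $B$-Lipschitz, and let $D\in\mathbb R$. Then there are constants $C,C'>0$, depending only on $\phi$ and $D$, such that the following holds for all integers $n,m,d,k\ge1$. **Network and initialization.** Let $u\in\mathbb R^d$, $W(0)\in\mathbb R^{k\times d}$, $V\in\mathbb R^{n\times k}$ be random, where $u$ is uniform on the unit sphere, $W(0)$ has iid $N(0,1)$ entries, $V$ has iid columns with identity covariance and centered entries that are almost surely bounded by $D$ in absolute value, $W(0)$ is independent of $u$, and $V$ is independent of $(W(0),u)$. Consider the network $g(u,W)=\frac1{\sqrt k}V\phi(Wu)$ ($\phi$ acting entrywise), where $V$ is fixed and only $W$ is trained. Let $\mathcal J(W)$ be its Jacobian with respect to $W$, let $\mathcal J(0)=\mathcal J(W(0))$, $y(0)=F(g(u,W(0)))$, and let $\sigma_{\min}$ be the smallest nonzero singular value (for the zero matrix, $\sigma_{\min}=0$). **Forward operator and loss.** Let $F\in C^1(\mathbb R^n;\mathbb R^m)$ with $F(0)=0$ have Jacobian $\mathcal J_F$ Lipschitz on bounded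 sets, let $\bar x\in\mathbb R^n$, $\varepsilon\in\mathbb R^m$ and $y=F(\bar x)+\varepsilon$. Let $\mathcal L\in C^1(\mathbb R^m)$ have gradient Lipschitz on bounded sets, $\min\mathcal L=0$ and $\mathcal L(y)=0$. Put $$L_{F,0}=\max_{\|x\|\le C\sqrt{n\log d}}\|\mathcal J_F(x)\|,\qquad \rho=C L_{F,0}\sqrt{n\log d}+\sqrt m\,(\|F(\bar x)\|_\infty+\|\varepsilon\|_\infty),\qquad L_{\mathcal L,0}=\sup_{\|v\|\le\rho,\ v\ne y}\frac{\|\nabla\mathcal L(v)\|}{\|v-y\|}.$$ Suppose that $\mathcal L$ satisfies the Kurdyka–Łojasiewicz inequality on $[0<\mathcal L<r_0]$ for some $r_0>\frac{L_{\mathcal L,0}}2\rho^2$: there is a strictly increasing $\psi\in C^0([0,r_0))\cap C^1((0,r_0))$ with $\psi(0)=0$ and $\psi'(\mathcal L(v))\|\nabla\mathcal L(v)\|\ge1$ whenever $0<\mathcal L(v)<r_0$. Suppose finally that either $\operatorname{Argmin}\mathcal L=\{y\}$ or $k\ge C'n\log n$. **Conclusion.** There is an event of probability at least $1-\frac1n-\frac1d$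 on which, for every parameter set $\Theta\subset\mathbb R^{k\times d}$ that contains $W(0)$ and satisfies $$\sigma_F:=\inf_{x\in\{g(u,W):W\in\Theta\}}\sigma_{\min}(\mathcal J_F(x))>0,\qquad k\ \ge\ C'\,\sigma_F^{-2}\,n\,\psi\Big(\frac{L_{\mathcal L,0}}2\rho^2\Big)^2,$$ the initialization condition holds: $\mathcal L(y(0))<r_0$, $\mathcal J(0)$ has full row rank (all its $n$ singular values are positive, so $\sigma_{\min}(\mathcal J(0))>0$), and $$R'=\frac{2}{\sigma_F\,\sigma_{\min}(\mathcal J(0))}\,\psi(\mathcal L(y(0)))\ <\ R .$$ Here $R$ is the radius determined by $R=\sigma_{\min}(\mathcal J(0))\big/\big(2\,\mathrm{Lip}_{B(W(0),R)}(\mathcal J)\big)$ with the Lipschitz constant taken from the Frobenius to the spectral norm; in general, also when this equation has no solution, $R\in[0,\infty]$ is the supremum of all $r\ge0$ with $2r\,\mathrm{Lip}_{B(W(0),r)}(\mathcal J)\le\sigma_{\min}(\mathcal J(0))$. -/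

import Mathlib

open MeasureTheory ProbabilityTheory
open scoped NNReal ENNReal Gradient

namespace DIP

noncomputable section

/-- `f` is Lipschitz continuous on every bounded set. -/
def LipschitzOnBounded {E F : Type*} [PseudoMetricSpace E] [PseudoMetricSpace F]
    (f : E → F) : Prop :=
  ∀ s : Set E, Bornology.IsBounded s → ∃ K : ℝ≥0, LipschitzOnWith K f s

/-- The smallest Lipschitz constant of `f` on `s`; it is `∞` if `f` is not Lipschitz on `s`. -/
def lipConst {E F : Type*} [PseudoEMetricSpace E] [PseudoEMetricSpace F]
    (f : E → F) (s : Set E) : ℝ≥0∞ :=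
  ⨅ (K : ℝ≥0) (_ : LipschitzOnWith K f s), (K : ℝ≥0∞)

/-- The smallest nonzero singular value of the matrix `T`, in variational form:
the infimum of `‖Tᵀ z‖ / ‖z‖` over the nonzero vectors `z` of the range of `T`.
For `T = 0` the value is `0`. -/
def sigmaMin {p q : Type*} [Fintype p] [Fintype q]
    (T : EuclideanSpace ℝ p →L[ℝ] EuclideanSpace ℝ q) : ℝ :=
  sInf {r : ℝ | ∃ z ∈ Set.range T, z ≠ 0 ∧ r = ‖ContinuousLinearMap.adjoint T z‖ / ‖z‖}

/-- The sup norm of a vector. -/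
def supNorm {m : ℕ} (v : EuclideanSpace ℝ (Fin m)) : ℝ := ⨆ i, |v i|

/-- The Kurdyka-Łojasiewicz inequality with desingularizing function `ψ` on `[0, r₀)`. -/
structure KLInequality {m : ℕ} (f : EuclideanSpace ℝ (Fin m) → ℝ) (ψ : ℝ → ℝ) (r₀ : ℝ) :
    Prop where
  pos : 0 < r₀
  contOn : ContinuousOn ψ (Set.Ico 0 r₀)
  contDiffOn : ContDiffOn ℝ 1 ψ (Set.Ioo 0 r₀)
  strictMonoOn : StrictMonoOn ψ (Set.Ico 0 r₀)
  map_zero : ψ 0 = 0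
  ineq : ∀ z, (⨅ x, f x) < f z → f z < (⨅ x, f x) + r₀ →
    1 ≤ deriv ψ (f z - ⨅ x, f x) * ‖∇ f z‖

/-- The loss: `C¹`, gradient Lipschitz on bounded sets, minimum value `0`, which is attained at
the observation `y`. -/
structure IsLoss {m : ℕ} (L : EuclideanSpace ℝ (Fin m) → ℝ) (y : EuclideanSpace ℝ (Fin m)) :
    Prop where
  contDiff : ContDiff ℝ 1 L
  lipschitz_gradient : LipschitzOnBounded (fun v => ∇ L v)
  min_zero : IsLeast (Set.range L) 0
  obs_min : L y = 0

/-- The activation: `C¹`, with bounded and Lipschitz derivative, and not constant. -/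
structure IsActivation (φ : ℝ → ℝ) : Prop where
  contDiff : ContDiff ℝ 1 φ
  deriv_bound : ∃ B : ℝ≥0, 0 < B ∧ (∀ x, |deriv φ x| ≤ B) ∧ LipschitzWith B (deriv φ)
  nonconstant : ∃ x x', φ x ≠ φ x'

/-- The forward operator: `C¹`, Jacobian Lipschitz on bounded sets, and `F 0 = 0`. -/
structure IsForwardOperator {n m : ℕ}
    (F : EuclideanSpace ℝ (Fin n) → EuclideanSpace ℝ (Fin m)) : Prop where
  contDiff : ContDiff ℝ 1 F
  lipschitz_jacobian : LipschitzOnBounded (fderiv ℝ F)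
  map_zero : F 0 = 0

/-- Hidden-layer weights: real `k × d` matrices with the Frobenius norm. -/
abbrev Weights (k d : ℕ) : Type := EuclideanSpace ℝ (Fin k × Fin d)

/-- The two-layer network `k^(-1/2) V φ(W u)`, `φ` acting entrywise. -/
def network {n k d : ℕ} (φ : ℝ → ℝ) (u : EuclideanSpace ℝ (Fin d))
    (V : Matrix (Fin n) (Fin k) ℝ) (W : Weights k d) : EuclideanSpace ℝ (Fin n) :=
  WithLp.toLp 2 fun i => (1 / √(k : ℝ)) * ∑ l, V i l * φ (∑ j, W (l, j) * u j)

/-- The Jacobian of the network with respect to the only trained parameter, `W`. -/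
def jacobian {n k d : ℕ} (φ : ℝ → ℝ) (u : EuclideanSpace ℝ (Fin d))
    (V : Matrix (Fin n) (Fin k) ℝ) (W : Weights k d) :
    Weights k d →L[ℝ] EuclideanSpace ℝ (Fin n) :=
  fderiv ℝ (network φ u V) W

/-- The infimum, over the signals `x` generated by the parameters in `Θ`, of the smallest nonzero
singular value of the Jacobian of `F` at `x`. -/
def sigmaF {n m k d : ℕ} (F : EuclideanSpace ℝ (Fin n) → EuclideanSpace ℝ (Fin m))
    (φ : ℝ → ℝ) (u : EuclideanSpace ℝ (Fin d)) (V : Matrix (Fin n) (Fin k) ℝ)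
    (Θ : Set (Weights k d)) : ℝ :=
  ⨅ x : network φ u V '' Θ, sigmaMin (fderiv ℝ F x)

/-- `R' = 2 ψ(L(y(0))) / (σ_F σ_min(J(0)))`, where `y(0) = F(g(u, W₀))`. -/
def radius' {n m k d : ℕ} (F : EuclideanSpace ℝ (Fin n) → EuclideanSpace ℝ (Fin m))
    (L : EuclideanSpace ℝ (Fin m) → ℝ) (ψ φ : ℝ → ℝ) (u : EuclideanSpace ℝ (Fin d))
    (V : Matrix (Fin n) (Fin k) ℝ) (Θ : Set (Weights k d)) (W₀ : Weights k d) : ℝ :=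
  2 / (sigmaF F φ u V Θ * sigmaMin (jacobian φ u V W₀)) * ψ (L (F (network φ u V W₀)))

/-- The radius `R` determined by `R = σ_min(J(0)) / (2 Lip_{B(W₀,R)}(J))`.
As `r * Lip_{B(W₀,r)}(J)` is nondecreasing in `r`, and strictly increasing where it is positive
and finite, a solution of this equation is unique when `σ_min(J(0)) > 0`, and it is then the
supremum of the radii `r` with `2 r Lip_{B(W₀,r)}(J) ≤ σ_min(J(0))`. The supremum also covers the
cases without a solution (`R = ∞` for a constant Jacobian, or a jump of the local constant). -/
def radius {n k d : ℕ} (φ : ℝ → ℝ) (u : EuclideanSpace ℝ (Fin d))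
    (V : Matrix (Fin n) (Fin k) ℝ) (W₀ : Weights k d) : ℝ≥0∞ :=
  ⨆ (r : ℝ≥0) (_ : 2 * r * lipConst (jacobian φ u V) (Metric.closedBall W₀ r) ≤
    ENNReal.ofReal (sigmaMin (jacobian φ u V W₀))), (r : ℝ≥0∞)

/-- The initialization condition `σ_min(J(0)) > 0` and `R' < R`. Positivity of `σ_min(J(0))` is
meant in the strong sense that all `n` singular values are positive, i.e. that `J(0)` has full
row rank. The initial loss is required to lie in the domain `[0, r₀)` of `ψ`. -/
structure InitCondition {n m k d : ℕ}
    (F : EuclideanSpace ℝ (Fin n) → EuclideanSpace ℝ (Fin m))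
    (L : EuclideanSpace ℝ (Fin m) → ℝ) (ψ : ℝ → ℝ) (r₀ : ℝ) (φ : ℝ → ℝ)
    (u : EuclideanSpace ℝ (Fin d)) (V : Matrix (Fin n) (Fin k) ℝ) (Θ : Set (Weights k d))
    (W₀ : Weights k d) : Prop where
  loss_lt : L (F (network φ u V W₀)) < r₀
  surjective : Function.Surjective (jacobian φ u V W₀)
  sigma_pos : 0 < sigmaMin (jacobian φ u V W₀)
  radius_lt : ENNReal.ofReal (radius' F L ψ φ u V Θ W₀) < radius φ u V W₀

/-- The uniform distribution on the unit sphere of `ℝ^d`: normalized surface measure. -/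
def uniformSphere (d : ℕ) : Measure (EuclideanSpace ℝ (Fin d)) :=
  let σ := (volume : Measure (EuclideanSpace ℝ (Fin d))).toSphere
  ((σ Set.univ)⁻¹ • σ).map Subtype.val

/-- Random input and initialization: `u` is uniform on the sphere, `W` has iid standard Gaussian
entries, `V` has iid columns with centered entries bounded by `D` and identity covariance;
`W` is independent of `u`, and `V` is independent of `(W, u)`. -/
structure IsInitialization {Ω : Type*} [MeasurableSpace Ω] (μ : Measure Ω) {n k d : ℕ} (D : ℝ)
    (u : Ω → EuclideanSpace ℝ (Fin d)) (W : Ω → Weights k d)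
    (V : Ω → Matrix (Fin n) (Fin k) ℝ) : Prop where
  measurable_u : Measurable u
  measurable_W : Measurable W
  measurable_V : ∀ i l, Measurable fun ω => V ω i l
  law_u : μ.map u = uniformSphere d
  law_W : ∀ e, μ.map (fun ω => W ω e) = gaussianReal 0 1
  indep_W : iIndepFun (fun e ω => W ω e) μ
  indep_col : iIndepFun (fun (l : Fin k) ω (i : Fin n) => V ω i l) μ
  ident_col : ∀ l l', IdentDistrib (fun ω (i : Fin n) => V ω i l) (fun ω i => V ω i l') μ μ
  bounded_V : ∀ i l, ∀ᵐ ω ∂μ, |V ω i l| ≤ D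
  centered_V : ∀ i l, ∫ ω, V ω i l ∂μ = 0
  cov_V : ∀ i i' l, ∫ ω, V ω i l * V ω i' l ∂μ = if i = i' then 1 else 0
  indep_W_u : IndepFun W u μ
  indep_V : IndepFun (fun ω (i : Fin n) (l : Fin k) => V ω i l) (fun ω => (W ω, u ω)) μ

/-- `L_{F,0}`: the maximum of the spectral norm of the Jacobian of `F` over the closed ball of
radius `C √(n log d)` about the origin. -/
def lipF {n m : ℕ} (d : ℕ) (C : ℝ)
    (F : EuclideanSpace ℝ (Fin n) → EuclideanSpace ℝ (Fin m)) : ℝ :=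
  ⨆ x : Metric.closedBall (0 : EuclideanSpace ℝ (Fin n)) (C * √(n * Real.log d)),
    ‖fderiv ℝ F x‖

/-- The bound `C L_{F,0} √(n log d) + √m (‖F x̄‖_∞ + ‖ε‖_∞)` on the initial misfit. -/
def misfit {n m : ℕ} (d : ℕ) (C : ℝ)
    (F : EuclideanSpace ℝ (Fin n) → EuclideanSpace ℝ (Fin m))
    (xbar : EuclideanSpace ℝ (Fin n)) (ε : EuclideanSpace ℝ (Fin m)) : ℝ :=
  C * lipF d C F * √(n * Real.log d) + √(m : ℝ) * (supNorm (F xbar) + supNorm ε)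

/-- `L_{L,0}`: the supremum of `‖∇L(v)‖ / ‖v - y‖` over the points `v ≠ y` of the closed ball of
radius `misfit` about the origin, where `y = F x̄ + ε` (the quotient is `0` at `v = y`). -/
def lipL {n m : ℕ} (d : ℕ) (C : ℝ)
    (F : EuclideanSpace ℝ (Fin n) → EuclideanSpace ℝ (Fin m))
    (L : EuclideanSpace ℝ (Fin m) → ℝ)
    (xbar : EuclideanSpace ℝ (Fin n)) (ε : EuclideanSpace ℝ (Fin m)) : ℝ :=
  ⨆ v : Metric.closedBall (0 : EuclideanSpace ℝ (Fin m)) (misfit d C F xbar ε),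
    ‖∇ L v‖ / ‖(v : EuclideanSpace ℝ (Fin m)) - (F xbar + ε)‖

/-- `(L_{L,0} / 2) misfit²`, the bound on the initial loss. -/
def lossBound {n m : ℕ} (d : ℕ) (C : ℝ)
    (F : EuclideanSpace ℝ (Fin n) → EuclideanSpace ℝ (Fin m))
    (L : EuclideanSpace ℝ (Fin m) → ℝ)
    (xbar : EuclideanSpace ℝ (Fin n)) (ε : EuclideanSpace ℝ (Fin m)) : ℝ :=
  lipL d C F L xbar ε / 2 * misfit d C F xbar ε ^ 2

end

end DIP

/-! Write h = W(0)u and let v_l be the columns of V. Since u is a unit vector independent of W(0),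
the h_l are iid standard Gaussian and independent of V. Everything then reduces to two random events
and a deterministic comparison.

Spectrum. J(0)J(0)ᵀ = k⁻¹ ∑ φ'(h_l)² v_l v_lᵀ has mean γ times the identity, with γ = E φ'(h)² > 0
because φ is not constant. A matrix Chernoff bound (`measure_exists_quadratic_le`) gives λ_min ≥ γ/4
off an event of probability 1/n once k ≥ C₁ n log n. The exponential of a sum of matrices is
replaced by products of factors 1 - t a v vᵀ with t → 0, and the trace inequality needed is
Araki-Lieb-Thirring for exponents 2^j (`trace_mul_pow_two_pow_le`), which is elementary.

Size of the output. Each coordinate of g(u, W(0)) is sub-Gaussian with a constant depending only on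
φ and D. Jensen's inequality over the coordinates gives ‖g‖ ≤ C √(n log d) off an event of
probability 1/d (`measure_lt_sum_sq_le`), whatever the dependence between coordinates. Integrating
along segments then bounds the initial misfit by ρ and the initial loss by L_{L,0} ρ²/2.

Comparison. The Jacobian is Lipschitz with constant Λ = √n D B / √k, so R ≥ σ_min(J(0)) / (2Λ), and
R' < R follows from 4Λψ < σ_F σ_min(J(0))². That is the assumed lower bound on k with a suitable C'
(`initCondition_of_good`).

Without the assumption k ≥ C' n log n, y is the only minimizer. The Kurdyka-Łojasiewicz inequality
then yields ‖v - y‖ ≤ ψ(L(v)) (`KLInequality.norm_sub_le`), hence ρ ≤ ψ(L_{L,0} ρ²/2). As σ_F ≤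
L_{F,0} on the second event, the lower bound on k already forces k ≥ C' C² n² log d ≥ C₁ n log n
(`width_lower_bound_of_unique`). -/

namespace DIP

/-! ### Araki-Lieb-Thirring trace inequality for dyadic exponents -/

section TraceInequality

open Matrix

lemma trace_transpose_mul_self_nonneg {ι : Type*} [Fintype ι] (Z : Matrix ι ι ℝ) : 0 ≤ trace (Zᵀ * Z) := by
  simp only [trace, diag_apply, mul_apply, transpose_apply]
  exact Finset.sum_nonneg fun i _ => Finset.sum_nonneg fun j _ => mul_self_nonneg _

variable {ι : Type*} [Fintype ι]

/-- Expand the squared Frobenius norm of Z - Zᵀ, which is nonnegative. -/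
lemma trace_mul_self_le (Z : Matrix ι ι ℝ) : trace (Z * Z) ≤ trace (Zᵀ * Z) := by
  have h := trace_transpose_mul_self_nonneg (Z - Zᵀ)
  have e1 : trace (Zᵀ * Zᵀ) = trace (Z * Z) := by
    rw [← transpose_mul, trace_transpose]
  have e2 : trace (Z * Zᵀ) = trace (Zᵀ * Z) := trace_mul_comm _ _
  simp only [transpose_sub, transpose_transpose, sub_mul, mul_sub, trace_sub, e1, e2] at h
  linarith

lemma two_mul_trace_mul_le {A B : Matrix ι ι ℝ} (hA : A.IsSymm) (hB : B.IsSymm) :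
    2 * trace (A * B) ≤ trace (A * A) + trace (B * B) := by
  have h := trace_transpose_mul_self_nonneg (A - B)
  have e : trace (B * A) = trace (A * B) := trace_mul_comm _ _
  simp only [transpose_sub, hA.eq, hB.eq, sub_mul, mul_sub, trace_sub, e] at h
  linarith

variable [DecidableEq ι]

lemma trace_mul_pow_comm (A B : Matrix ι ι ℝ) (s : ℕ) :
    trace ((A * B) ^ s) = trace ((B * A) ^ s) := by
  cases s with
  | zero => simp
  | succ s =>
    have h : ∀ s : ℕ, (A * B) ^ s * A = A * (B * A) ^ s := by
      intro s
      induction s with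
      | zero => simp
      | succ s ih => rw [pow_succ', mul_assoc, ih, pow_succ']; simp only [mul_assoc]
    rw [pow_succ, ← mul_assoc, h, mul_assoc, trace_mul_comm, pow_succ, mul_assoc]

/-- A Weyl-type inequality: powers are moved outside the Gram matrix, halving the inner exponent and
doubling the outer one. It is half of a joint induction: the Araki-Lieb-Thirring inequality for
smaller dyadic exponents enters as a hypothesis. -/
lemma trace_transpose_pow_mul_pow_le (X : Matrix ι ι ℝ) (a : ℕ) : ∀ b : ℕ,
    (∀ j < a + b, ∀ A B : Matrix ι ι ℝ, A.IsSymm → B.IsSymm →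
      trace ((A * B) ^ 2 ^ j) ≤ trace (A ^ 2 ^ j * B ^ 2 ^ j)) →
    trace ((Xᵀ ^ 2 ^ a * X ^ 2 ^ a) ^ 2 ^ b) ≤ trace ((Xᵀ * X) ^ 2 ^ (a + b)) := by
  induction a with
  | zero => intro b _; simp
  | succ a ih =>
    intro b hT
    set Z := X ^ 2 ^ a with hZ
    have hZt : Xᵀ ^ 2 ^ a = Zᵀ := by rw [hZ, transpose_pow]
    have h1 : Xᵀ ^ 2 ^ (a + 1) * X ^ 2 ^ (a + 1) = Zᵀ * (Zᵀ * Z * Z) := by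
      rw [pow_succ, pow_mul, pow_mul, hZt, ← hZ]; simp only [pow_two, mul_assoc]
    have s1 : (Zᵀ * Z).IsSymm := isSymm_transpose_mul_self Z
    have s2 : (Z * Zᵀ).IsSymm := isSymm_mul_transpose_self Z
    have h2 := hT b (by omega) _ _ s1 s2
    -- ZᵀZ and ZZᵀ have the same traces of powers, so both terms on the right of the AM-GM bound
    -- coincide.
    have h3 := two_mul_trace_mul_le (s1.pow (2 ^ b)) (s2.pow (2 ^ b))
    rw [← pow_add, ← pow_add, trace_mul_pow_comm Z Zᵀ] at h3
    have h4 := ih (b + 1) (fun j hj => hT j (by omega))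
    rw [hZt] at h4
    rw [h1, trace_mul_pow_comm]
    have e1 : (2 : ℕ) ^ b + 2 ^ b = 2 ^ (b + 1) := by ring
    have e2 : a + 1 + b = a + (b + 1) := by ring
    rw [e1] at h3
    rw [e2, show Zᵀ * Z * Z * Zᵀ = Zᵀ * Z * (Z * Zᵀ) by simp only [mul_assoc]]
    linarith

/-- The Araki-Lieb-Thirring inequality for exponents that are powers of two. -/
theorem trace_mul_pow_two_pow_le (i : ℕ) : ∀ A B : Matrix ι ι ℝ, A.IsSymm → B.IsSymm →
    trace ((A * B) ^ 2 ^ i) ≤ trace (A ^ 2 ^ i * B ^ 2 ^ i) := by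
  induction i using Nat.strong_induction_on with
  | _ i ih =>
    intro A B hA hB
    cases i with
    | zero => simp
    | succ i =>
      -- With Y = (AB)^(2^i): tr Y² ≤ tr YᵀY ≤ tr (BA·AB)^(2^i) = tr (A²B²)^(2^i), and the induction
      -- hypothesis is applied to A² and B².
      have h1 := trace_mul_self_le ((A * B) ^ 2 ^ i)
      rw [← pow_add, transpose_pow] at h1
      have h2 := trace_transpose_pow_mul_pow_le (A * B) i 0 (fun j hj => ih j (by omega))
      have h3 := ih i (by omega) (A * A) (B * B) (by simpa [hA.eq] using isSymm_mul_transpose_self A)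
        (by simpa [hB.eq] using isSymm_mul_transpose_self B)
      have e1 : (2 : ℕ) ^ i + 2 ^ i = 2 ^ (i + 1) := by ring
      rw [e1] at h1
      rw [transpose_mul, hA.eq, hB.eq, pow_zero, pow_one, add_zero, mul_assoc B, trace_mul_pow_comm B,
        show A * (A * B) * B = A * A * (B * B) by simp only [mul_assoc]] at h2
      rw [← pow_two A, ← pow_two B, ← pow_mul, ← pow_mul, ← pow_succ'] at h3
      rw [transpose_mul, hA.eq, hB.eq] at h1
      rw [← pow_two A, ← pow_two B] at h2
      linarith

end TraceInequality

/-! ### Products of rank-one shrinkages: deterministic estimates -/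

section Chernoff

open Matrix

/-- The symmetric factor `1 - t a v vᵀ`. -/
def shrink {n : ℕ} (t a : ℝ) (v : Fin n → ℝ) : Matrix (Fin n) (Fin n) ℝ :=
  1 - (t * a) • vecMulVec v v

/-- The ordered product of the factors `1 - t aₗ vₗ vₗᵀ`. -/
def shrinkProd {n : ℕ} (t : ℝ) : (k : ℕ) → (Fin k → ℝ) → (Fin k → Fin n → ℝ) →
    Matrix (Fin n) (Fin n) ℝ
  | 0, _, _ => 1
  | k + 1, a, v => shrinkProd t k (Fin.tail a) (Fin.tail v) * shrink t (a 0) (v 0)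

/-- The Gram matrix of `shrinkProd`. -/
def shrinkGram {n : ℕ} (t : ℝ) (k : ℕ) (a : Fin k → ℝ) (v : Fin k → Fin n → ℝ) :
    Matrix (Fin n) (Fin n) ℝ :=
  (shrinkProd t k a v)ᵀ * shrinkProd t k a v

variable {n k : ℕ} {t K : ℝ}

lemma shrink_isSymm (t a : ℝ) (v : Fin n → ℝ) : (shrink t a v).IsSymm := by
  simp [shrink, Matrix.IsSymm, transpose_vecMulVec]

lemma shrink_mulVec (t a : ℝ) (v w : Fin n → ℝ) :
    shrink t a v *ᵥ w = w - (t * a * (v ⬝ᵥ w)) • v := by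
  ext i
  simp [shrink, sub_mulVec, smul_mulVec, vecMulVec_mulVec]
  ring

lemma shrinkGram_isSymm (t : ℝ) (a : Fin k → ℝ) (v : Fin k → Fin n → ℝ) :
    (shrinkGram t k a v).IsSymm := isSymm_transpose_mul_self _

lemma shrinkGram_succ (t : ℝ) (a : Fin (k + 1) → ℝ) (v : Fin (k + 1) → Fin n → ℝ) :
    shrinkGram t (k + 1) a v = shrink t (a 0) (v 0) *
      (shrinkGram t k (Fin.tail a) (Fin.tail v) * shrink t (a 0) (v 0)) := by
  simp only [shrinkGram, shrinkProd, transpose_mul, (shrink_isSymm _ _ _).eq, mul_assoc]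

lemma vecMulVec_self_mul_self (v : Fin n → ℝ) :
    vecMulVec v v * vecMulVec v v = (v ⬝ᵥ v) • vecMulVec v v := by
  rw [vecMulVec_mul_vecMulVec, vecMulVec_smul]

/-- Powers of 1 - t a v vᵀ stay in the span of 1 and v vᵀ. The coefficient is 1 - (1 - ty)^N divided
by y = a|v|², and its second-order lower bound is uniform in v. -/
lemma exists_shrink_pow_eq {a : ℝ} {v : Fin n → ℝ} (ht : 0 ≤ t) (ha : 0 ≤ a)
    (hv : a * (v ⬝ᵥ v) ≤ K) (htK : t * K ≤ 1) (N : ℕ) :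
    ∃ β, N * t * (1 - N * t * K) ≤ β ∧ shrink t a v ^ N = 1 - (a * β) • vecMulVec v v := by
  set y := a * (v ⬝ᵥ v) with hy
  have hy0 : 0 ≤ y := mul_nonneg ha (by simpa using dotProduct_star_self_nonneg v)
  suffices h : ∃ β, N * t * (1 - N * t * y) ≤ β ∧
      shrink t a v ^ N = 1 - (a * β) • vecMulVec v v by
    obtain ⟨β, h1, h2⟩ := h
    refine ⟨β, le_trans ?_ h1, h2⟩
    gcongr
  have hty : t * y ≤ 1 := le_trans (by gcongr) htK
  induction N with
  | zero => exact ⟨0, by simp, by simp⟩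
  | succ N ih =>
    obtain ⟨β, h1, h2⟩ := ih
    -- Multiplying by one more factor, with (v vᵀ)² = |v|² v vᵀ.
    refine ⟨β * (1 - t * y) + t, ?_, ?_⟩
    · have h3 := mul_le_mul_of_nonneg_right h1 (sub_nonneg.2 hty)
      have h4 : 0 ≤ (N : ℝ) ^ 2 * t * (t * y) ^ 2 := by positivity
      have h5 : 0 ≤ t * (t * y) * (N + 1) := by positivity
      push_cast
      nlinarith
    · rw [pow_succ, h2, shrink]
      simp only [sub_mul, mul_sub, one_mul, mul_one, smul_mul_smul_comm, vecMulVec_self_mul_self,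
        smul_smul]
      rw [hy]
      module

lemma trace_mul_vecMulVec_self (M : Matrix (Fin n) (Fin n) ℝ) (v : Fin n → ℝ) :
    trace (M * vecMulVec v v) = v ⬝ᵥ M *ᵥ v := by
  rw [mul_vecMulVec, trace_vecMulVec, dotProduct_comm]

lemma isSymm_dotProduct_mulVec_pow_two_mul {M : Matrix (Fin n) (Fin n) ℝ} (hM : M.IsSymm)
    (p : ℕ) (x : Fin n → ℝ) :
    x ⬝ᵥ (M ^ (p + p)) *ᵥ x = (M ^ p *ᵥ x) ⬝ᵥ (M ^ p *ᵥ x) := by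
  rw [pow_add, ← mulVec_mulVec, dotProduct_mulVec, ← mulVec_transpose, (hM.pow p).eq]

/-- The newest factor S is outermost, so cyclicity gives tr (P S²)^(2^j), and Araki-Lieb-Thirring
separates S from P. The bound is affine in v₀v₀ᵀ, so v₀ can be integrated out using its covariance
alone. -/
lemma trace_shrinkGram_pow_succ_le (ht : 0 ≤ t) (htK : t * K ≤ 1) (j : ℕ)
    (a : Fin (k + 1) → ℝ) (v : Fin (k + 1) → Fin n → ℝ) (ha : 0 ≤ a 0)
    (hv : a 0 * (v 0 ⬝ᵥ v 0) ≤ K) (hj : 1 ≤ j) :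
    trace (shrinkGram t (k + 1) a v ^ 2 ^ j) ≤
      trace (shrinkGram t k (Fin.tail a) (Fin.tail v) ^ 2 ^ j) -
      a 0 * ((2 ^ (j + 1) : ℕ) * t * (1 - (2 ^ (j + 1) : ℕ) * t * K)) *
        (v 0 ⬝ᵥ (shrinkGram t k (Fin.tail a) (Fin.tail v) ^ 2 ^ j) *ᵥ v 0) := by
  set S := shrink t (a 0) (v 0)
  set P := shrinkGram t k (Fin.tail a) (Fin.tail v)
  have hS : S.IsSymm := shrink_isSymm _ _ _
  have hP : P.IsSymm := shrinkGram_isSymm _ _ _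
  have h1 : trace (shrinkGram t (k + 1) a v ^ 2 ^ j) = trace ((P * (S * S)) ^ 2 ^ j) := by
    rw [shrinkGram_succ, trace_mul_pow_comm, mul_assoc]
  have h2 := trace_mul_pow_two_pow_le j P (S * S) hP
    (by simpa [hS.eq] using isSymm_mul_transpose_self S)
  obtain ⟨β, hβ, hS2⟩ := exists_shrink_pow_eq ht ha hv htK (2 ^ (j + 1))
  rw [← pow_two S, ← pow_mul, ← pow_succ', hS2, mul_sub, mul_one, trace_sub, mul_smul_comm,
    trace_smul, trace_mul_vecMulVec_self, smul_eq_mul] at h2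
  -- For j ≥ 1 the exponent is even, so the quadratic form is a squared norm.
  have h3 : 0 ≤ v 0 ⬝ᵥ (P ^ 2 ^ j) *ᵥ v 0 := by
    obtain ⟨i, rfl⟩ : ∃ i, j = i + 1 := ⟨j - 1, by omega⟩
    rw [pow_succ 2 i, mul_two, isSymm_dotProduct_mulVec_pow_two_mul hP]
    simpa using dotProduct_star_self_nonneg (P ^ 2 ^ i *ᵥ v 0)
  rw [h1, ← pow_two S]
  refine h2.trans ?_
  gcongr

lemma dotProduct_le_norm_mul_norm (x y : Fin n → ℝ) :
    |x ⬝ᵥ y| ≤ ‖WithLp.toLp 2 x‖ * ‖WithLp.toLp 2 y‖ := by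
  have h := abs_real_inner_le_norm (WithLp.toLp 2 x) (WithLp.toLp 2 y)
  simpa [PiLp.inner_apply, dotProduct, mul_comm] using h

lemma dotProduct_self_eq_norm_sq (x : Fin n → ℝ) : x ⬝ᵥ x = ‖WithLp.toLp 2 x‖ ^ 2 := by
  rw [EuclideanSpace.real_norm_sq_eq]
  simp [dotProduct, pow_two]

lemma abs_rankOne_le {a : ℝ} {v x w : Fin n → ℝ} (ha : 0 ≤ a) (hv : a * (v ⬝ᵥ v) ≤ K) :
    |a * (v ⬝ᵥ w) * (v ⬝ᵥ x)| ≤ K * ‖WithLp.toLp 2 w‖ * ‖WithLp.toLp 2 x‖ := by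
  rw [dotProduct_self_eq_norm_sq] at hv
  rw [abs_mul, abs_mul, abs_of_nonneg ha]
  calc a * |v ⬝ᵥ w| * |v ⬝ᵥ x|
      ≤ a * (‖WithLp.toLp 2 v‖ * ‖WithLp.toLp 2 w‖) * (‖WithLp.toLp 2 v‖ * ‖WithLp.toLp 2 x‖) := by
        gcongr <;> exact dotProduct_le_norm_mul_norm _ _
    _ = (a * ‖WithLp.toLp 2 v‖ ^ 2) * ‖WithLp.toLp 2 w‖ * ‖WithLp.toLp 2 x‖ := by ring
    _ ≤ _ := by gcongr

lemma norm_shrink_mulVec_le {a : ℝ} {v w : Fin n → ℝ} (ht : 0 ≤ t) (ha : 0 ≤ a)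
    (hv : a * (v ⬝ᵥ v) ≤ K) (htK : t * K ≤ 1) :
    ‖WithLp.toLp 2 (shrink t a v *ᵥ w)‖ ≤ ‖WithLp.toLp 2 w‖ := by
  rw [← sq_le_sq₀ (norm_nonneg _) (norm_nonneg _), ← dotProduct_self_eq_norm_sq,
    ← dotProduct_self_eq_norm_sq, shrink_mulVec]
  simp only [sub_dotProduct, dotProduct_sub, smul_dotProduct, dotProduct_smul, smul_eq_mul]
  rw [dotProduct_comm w v]
  have h1 : t * (a * (v ⬝ᵥ v)) ≤ 1 := le_trans (by gcongr) htK
  have h2 : 0 ≤ t * a * (v ⬝ᵥ w) ^ 2 := by positivity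
  nlinarith

/-- First-order expansion of the product in t. Each factor moves w by at most tK, so replacing w by
x in one rank-one term costs tK times the drift accumulated so far; δ tracks that drift through the
induction. -/
lemma le_dotProduct_shrinkProd_mulVec (ht : 0 ≤ t) (htK : t * K ≤ 1) (hK : 0 ≤ K)
    {x : Fin n → ℝ} (hx : ‖WithLp.toLp 2 x‖ = 1) : ∀ (k : ℕ) (a : Fin k → ℝ)
    (v : Fin k → Fin n → ℝ), (∀ l, 0 ≤ a l) → (∀ l, a l * (v l ⬝ᵥ v l) ≤ K) →
    ∀ (w : Fin n → ℝ) (δ : ℝ), ‖WithLp.toLp 2 w‖ ≤ 1 → ‖WithLp.toLp 2 (w - x)‖ ≤ δ →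
    x ⬝ᵥ w - t * ∑ l, a l * (v l ⬝ᵥ x) ^ 2 - k * (t * K) * (δ + k * (t * K)) ≤
      x ⬝ᵥ shrinkProd t k a v *ᵥ w := by
  intro k
  induction k with
  | zero => intro a v _ _ w δ _ _; simp [shrinkProd]
  | succ k ih =>
    intro a v ha hv w δ hw hδ
    have h1 := ih (Fin.tail a) (Fin.tail v) (fun l => ha l.succ) (fun l => hv l.succ)
      (shrink t (a 0) (v 0) *ᵥ w) (δ + t * K)
      ((norm_shrink_mulVec_le ht (ha 0) (hv 0) htK).trans hw) ?_
    · rw [shrinkProd, ← mulVec_mulVec]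
      refine le_trans ?_ h1
      rw [shrink_mulVec, dotProduct_sub, dotProduct_smul, Fin.sum_univ_succ, smul_eq_mul]
      have h2 := (abs_le.1 (abs_rankOne_le (x := x) (w := w - x) (ha 0) (hv 0))).2
      rw [hx, mul_one, dotProduct_sub] at h2
      have h3 : K * ‖WithLp.toLp 2 (w - x)‖ ≤ K * δ := by gcongr
      have h4 := mul_le_mul_of_nonneg_left (h2.trans h3) ht
      have h5 : 0 ≤ (t * K) ^ 2 := sq_nonneg _
      have h6 : 0 ≤ (k : ℝ) * (t * K) ^ 2 := by positivity
      rw [dotProduct_comm x (v 0)]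
      simp only [Fin.tail]
      push_cast
      nlinarith
    · rw [shrink_mulVec]
      have e : WithLp.toLp 2 (w - (t * a 0 * (v 0 ⬝ᵥ w)) • v 0 - x) =
          WithLp.toLp 2 (w - x) - (t * a 0 * (v 0 ⬝ᵥ w)) • WithLp.toLp 2 (v 0) := by
        ext i; simp; ring
      rw [e]
      refine (norm_sub_le _ _).trans (add_le_add hδ ?_)
      rw [norm_smul, Real.norm_eq_abs, abs_mul, abs_mul, abs_of_nonneg ht, abs_of_nonneg (ha 0)]
      have h2 := hv 0
      rw [dotProduct_self_eq_norm_sq] at h2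
      calc t * a 0 * |v 0 ⬝ᵥ w| * ‖WithLp.toLp 2 (v 0)‖
          ≤ t * a 0 * (‖WithLp.toLp 2 (v 0)‖ * 1) * ‖WithLp.toLp 2 (v 0)‖ := by
            have := ha 0
            gcongr
            exact (dotProduct_le_norm_mul_norm _ _).trans (by gcongr)
        _ = t * (a 0 * ‖WithLp.toLp 2 (v 0)‖ ^ 2) := by ring
        _ ≤ t * K := by gcongr

/-- Cauchy-Schwarz gives (xᵀNx)² ≤ |Nx|² = xᵀN²x for symmetric N; iterate the squaring. -/
lemma dotProduct_mulVec_pow_two_pow_le {M : Matrix (Fin n) (Fin n) ℝ} (hM : M.IsSymm)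
    {x : Fin n → ℝ} (hx : ‖WithLp.toLp 2 x‖ = 1) (hpos : 0 ≤ x ⬝ᵥ M *ᵥ x) (j : ℕ) :
    (x ⬝ᵥ M *ᵥ x) ^ 2 ^ j ≤ x ⬝ᵥ M ^ 2 ^ j *ᵥ x := by
  induction j with
  | zero => simp
  | succ j ih =>
    rw [pow_succ 2 j, mul_two, isSymm_dotProduct_mulVec_pow_two_mul hM, pow_add, ← pow_two,
      dotProduct_self_eq_norm_sq]
    have h1 := (abs_le.1 (dotProduct_le_norm_mul_norm x (M ^ 2 ^ j *ᵥ x))).2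
    rw [hx, one_mul] at h1
    have h2 := ih.trans h1
    gcongr

lemma dotProduct_mulVec_le_trace {M : Matrix (Fin n) (Fin n) ℝ} (hM : M.IsSymm) {j : ℕ}
    (hj : 1 ≤ j) {x : Fin n → ℝ} (hx : ‖WithLp.toLp 2 x‖ = 1) :
    x ⬝ᵥ M ^ 2 ^ j *ᵥ x ≤ trace (M ^ 2 ^ j) := by
  obtain ⟨i, rfl⟩ : ∃ i, j = i + 1 := ⟨j - 1, by omega⟩
  rw [pow_succ 2 i, mul_two, isSymm_dotProduct_mulVec_pow_two_mul hM, pow_add]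
  have hN := (hM.pow (2 ^ i)).eq
  set N := M ^ 2 ^ i
  have hx2 : ∑ i, x i ^ 2 = 1 := by
    have := dotProduct_self_eq_norm_sq x
    rw [hx] at this
    simpa [dotProduct, pow_two] using this
  have e : trace (N * N) = ∑ i, ∑ j, N i j ^ 2 := by
    nth_rw 2 [← hN]
    simp [trace, mul_apply, pow_two]
  rw [e]
  simp only [dotProduct, mulVec, ← pow_two]
  refine Finset.sum_le_sum fun i _ => ?_
  have := Finset.sum_mul_sq_le_sq_mul_sq Finset.univ (N i) x
  rwa [hx2, mul_one] at this

/-- A direction x in which the weighted sum of squares is at most s is barely shrunk: |Prod x| ≥ xᵀ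
Prod x ≥ 1 - ts - O(t²). This one direction already makes the trace large. -/
lemma le_trace_shrinkGram_pow (ht : 0 ≤ t) (htK : t * K ≤ 1) (hK : 0 ≤ K)
    {a : Fin k → ℝ} {v : Fin k → Fin n → ℝ} (ha : ∀ l, 0 ≤ a l)
    (hv : ∀ l, a l * (v l ⬝ᵥ v l) ≤ K) {x : Fin n → ℝ} (hx : ‖WithLp.toLp 2 x‖ = 1) {s : ℝ}
    (hs : ∑ l, a l * (v l ⬝ᵥ x) ^ 2 ≤ s) {j : ℕ} (hj : 1 ≤ j)
    (hpos : 0 ≤ 1 - t * s - (k * (t * K)) ^ 2) :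
    (1 - t * s - (k * (t * K)) ^ 2) ^ 2 ^ (j + 1) ≤ trace (shrinkGram t k a v ^ 2 ^ j) := by
  have h1 := le_dotProduct_shrinkProd_mulVec ht htK hK hx k a v ha hv x 0 hx.le (by simp)
  rw [dotProduct_self_eq_norm_sq, hx] at h1
  have h2 : 1 - t * s - (k * (t * K)) ^ 2 ≤ x ⬝ᵥ shrinkProd t k a v *ᵥ x := by
    have := mul_le_mul_of_nonneg_left hs ht
    nlinarith
  have h3 := (h2.trans (le_abs_self _)).trans (dotProduct_le_norm_mul_norm _ _)
  rw [hx, one_mul] at h3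
  have h4 : x ⬝ᵥ shrinkGram t k a v *ᵥ x = ‖WithLp.toLp 2 (shrinkProd t k a v *ᵥ x)‖ ^ 2 := by
    rw [← dotProduct_self_eq_norm_sq, shrinkGram, ← mulVec_mulVec, dotProduct_mulVec,
      vecMul_transpose]
  have hS := shrinkGram_isSymm t a v
  refine le_trans ?_ (dotProduct_mulVec_le_trace hS hj hx)
  refine le_trans ?_ (dotProduct_mulVec_pow_two_pow_le hS hx (by rw [h4]; positivity) j)
  rw [h4, ← pow_mul, show 2 ^ (j + 1) = 2 * 2 ^ j from pow_succ' 2 j]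
  gcongr

end Chernoff

/-! ### Matrix Chernoff bound for random columns -/

section Chernoff

open Matrix

/-- A probability measure on `ℝⁿ` with centered entries bounded by `D` and identity covariance. -/
structure IsColumnLaw {n : ℕ} (D : ℝ) (ν : Measure (Fin n → ℝ)) : Prop where
  prob : IsProbabilityMeasure ν
  bounded : ∀ᵐ v ∂ν, ∀ i, |v i| ≤ D
  centered : ∀ i, ∫ v, v i ∂ν = 0
  cov : ∀ i i', ∫ v, v i * v i' ∂ν = if i = i' then 1 else 0

variable {n k : ℕ} {t K D : ℝ}

lemma IsColumnLaw.integrable_mul {ν : Measure (Fin n → ℝ)} (hν : IsColumnLaw D ν) (i i' : Fin n) :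
    Integrable (fun v => v i * v i') ν := by
  have := hν.prob
  refine Integrable.of_bound (C := D * D) (by fun_prop) ?_
  filter_upwards [hν.bounded] with v hv
  rw [norm_mul]
  exact mul_le_mul (hv i) (hv i') (norm_nonneg _) ((abs_nonneg _).trans (hv i))

lemma dotProduct_mulVec_eq_sum (M : Matrix (Fin n) (Fin n) ℝ) (v : Fin n → ℝ) :
    v ⬝ᵥ M *ᵥ v = ∑ i, ∑ i', M i i' * (v i * v i') := by
  simp only [dotProduct, mulVec, Finset.mul_sum]
  exact Finset.sum_congr rfl fun i _ => Finset.sum_congr rfl fun i' _ => by ring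

lemma IsColumnLaw.integrable_quadratic {ν : Measure (Fin n → ℝ)} (hν : IsColumnLaw D ν)
    (M : Matrix (Fin n) (Fin n) ℝ) : Integrable (fun v => v ⬝ᵥ M *ᵥ v) ν := by
  simp only [dotProduct_mulVec_eq_sum]
  exact integrable_finsetSum _ fun i _ => integrable_finsetSum _ fun i' _ =>
    (hν.integrable_mul i i').const_mul _

lemma IsColumnLaw.integral_quadratic {ν : Measure (Fin n → ℝ)} (hν : IsColumnLaw D ν)
    (M : Matrix (Fin n) (Fin n) ℝ) : ∫ v, v ⬝ᵥ M *ᵥ v ∂ν = trace M := by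
  simp only [dotProduct_mulVec_eq_sum]
  refine (integral_finsetSum _ fun i _ => integrable_finsetSum _ fun i' _ =>
    (hν.integrable_mul i i').const_mul (M i i')).trans ?_
  refine Finset.sum_congr rfl fun i _ => ?_
  refine (integral_finsetSum _ fun i' _ => (hν.integrable_mul i i').const_mul (M i i')).trans ?_
  simp only [integral_const_mul, hν.cov]
  simp

lemma dotProduct_self_le_of_abs_le {v : Fin n → ℝ} (hv : ∀ i, |v i| ≤ D) :
    v ⬝ᵥ v ≤ D ^ 2 * n := by
  have : ∀ i ∈ Finset.univ, v i * v i ≤ D ^ 2 := fun i _ => by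
    rw [← pow_two, ← sq_abs]
    have := hv i
    gcongr
  simpa [dotProduct, mul_comm] using Finset.sum_le_card_nsmul _ _ _ this

lemma continuous_shrinkProd (t : ℝ) (k : ℕ) :
    Continuous fun p : (Fin k → ℝ) × (Fin k → Fin n → ℝ) => shrinkProd t k p.1 p.2 := by
  induction k with
  | zero => exact continuous_const
  | succ k ih =>
    simp only [shrinkProd]
    refine Continuous.matrix_mul ?_ ?_
    · have h : Continuous fun p : (Fin (k + 1) → ℝ) × (Fin (k + 1) → Fin n → ℝ) =>
          ((Fin.tail p.1, Fin.tail p.2) : (Fin k → ℝ) × (Fin k → Fin n → ℝ)) := by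
        unfold Fin.tail
        fun_prop
      exact ih.comp h
    · unfold shrink
      have h1 : Continuous fun p : (Fin (k + 1) → ℝ) × (Fin (k + 1) → Fin n → ℝ) => t * p.1 0 := by
        fun_prop
      have h2 : Continuous fun p : (Fin (k + 1) → ℝ) × (Fin (k + 1) → Fin n → ℝ) => p.2 0 := by
        fun_prop
      exact continuous_const.sub (h1.smul (h2.matrix_vecMulVec h2))

lemma continuous_shrinkGram (t : ℝ) (k : ℕ) :
    Continuous fun p : (Fin k → ℝ) × (Fin k → Fin n → ℝ) => shrinkGram t k p.1 p.2 :=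
  (continuous_shrinkProd t k).matrix_transpose.matrix_mul (continuous_shrinkProd t k)

lemma trace_shrinkGram_pow_nonneg {a : Fin k → ℝ} {v : Fin k → Fin n → ℝ} {j : ℕ} (hj : 1 ≤ j) :
    0 ≤ trace (shrinkGram t k a v ^ 2 ^ j) := by
  obtain ⟨i, rfl⟩ : ∃ i, j = i + 1 := ⟨j - 1, by omega⟩
  have h := trace_transpose_mul_self_nonneg (shrinkGram t k a v ^ 2 ^ i)
  rwa [((shrinkGram_isSymm t a v).pow _).eq, ← pow_add, ← two_mul, ← pow_succ'] at h

/-- Integrating out the head column with E v vᵀ = 1 turns its correction into a multiple of the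
trace, so each column contributes the scalar factor 1 - c aₗ; the initial trace is n. -/
lemma lintegral_trace_shrinkGram_pow_le (ht : 0 ≤ t) (htK : t * K ≤ 1) {j : ℕ} (hj : 1 ≤ j)
    {c : ℝ} (hc : c = (2 ^ (j + 1) : ℕ) * t * (1 - (2 ^ (j + 1) : ℕ) * t * K)) :
    ∀ (k : ℕ) (a : Fin k → ℝ) (ν : Fin k → Measure (Fin n → ℝ)), (∀ l, IsColumnLaw D (ν l)) →
    (∀ l, 0 ≤ a l) → (∀ l, c * a l ≤ 1) → (∀ l, a l * (D ^ 2 * n) ≤ K) →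
    ∫⁻ v, ENNReal.ofReal (trace (shrinkGram t k a v ^ 2 ^ j)) ∂(Measure.pi ν) ≤
      ENNReal.ofReal (n * ∏ l, (1 - c * a l)) := by
  intro k
  induction k with
  | zero =>
    intro a ν hν _ _ _
    have := fun l => (hν l).prob
    simp [shrinkGram, shrinkProd]
  | succ k ih =>
    intro a ν hν ha hca haK
    have := fun l => (hν l).prob
    set G : (Fin k → Fin n → ℝ) → Matrix (Fin n) (Fin n) ℝ :=
      fun v => shrinkGram t k (Fin.tail a) v ^ 2 ^ j with hG
    have hGc : Continuous G :=
      ((continuous_shrinkGram t k).comp (by fun_prop : Continuous fun v => (Fin.tail a, v))).pow _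
    set f : (Fin n → ℝ) × (Fin k → Fin n → ℝ) → ℝ≥0∞ :=
      fun z => ENNReal.ofReal (trace (G z.2) - a 0 * c * (z.1 ⬝ᵥ G z.2 *ᵥ z.1)) with hf
    have hfm : Measurable f := by
      refine ENNReal.measurable_ofReal.comp (Continuous.measurable ?_)
      have h2 : Continuous fun z : (Fin n → ℝ) × (Fin k → Fin n → ℝ) => G z.2 :=
        hGc.comp continuous_snd
      exact h2.matrix_trace.sub (continuous_const.mul
        (continuous_fst.dotProduct (h2.matrix_mulVec continuous_fst)))
    have hmp := measurePreserving_piFinSuccAbove ν 0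
    have hae : ∀ᵐ v ∂(Measure.pi ν), ∀ i, |v 0 i| ≤ D :=
      (Measure.quasiMeasurePreserving_eval ν 0).ae (hν 0).bounded
    calc ∫⁻ v, ENNReal.ofReal (trace (shrinkGram t (k + 1) a v ^ 2 ^ j)) ∂(Measure.pi ν)
        ≤ ∫⁻ v, f (MeasurableEquiv.piFinSuccAbove (fun _ => Fin n → ℝ) 0 v) ∂(Measure.pi ν) := by
          refine lintegral_mono_ae ?_
          filter_upwards [hae] with v hv
          refine ENNReal.ofReal_le_ofReal ?_
          have h := trace_shrinkGram_pow_succ_le ht htK j a v (ha 0)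
            (le_trans (mul_le_mul_of_nonneg_left (dotProduct_self_le_of_abs_le hv) (ha 0)) (haK 0)) hj
          rw [← hc] at h
          exact h
      _ = ∫⁻ z, f z ∂((ν 0).prod (Measure.pi fun l => ν (Fin.succAbove 0 l))) :=
          hmp.lintegral_comp hfm
      _ = ∫⁻ v, ∫⁻ w, f (w, v) ∂(ν 0) ∂(Measure.pi fun l => ν (Fin.succAbove 0 l)) :=
          lintegral_prod_symm' _ hfm
      _ = ∫⁻ v, ENNReal.ofReal (1 - c * a 0) * ENNReal.ofReal (trace (G v))
            ∂(Measure.pi fun l => ν (Fin.succAbove 0 l)) := by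
          refine lintegral_congr fun v => ?_
          simp only [hf]
          have hi := ((hν 0).integrable_quadratic (G v)).const_mul (a 0 * c)
          rw [← ofReal_integral_eq_lintegral_ofReal
              (f := fun w => trace (G v) - a 0 * c * (w ⬝ᵥ G v *ᵥ w)) ((integrable_const _).sub hi),
            integral_sub (integrable_const _) hi, integral_const_mul,
            (hν 0).integral_quadratic, ← ENNReal.ofReal_mul (sub_nonneg.2 (hca 0))]
          · simp only [integral_const, probReal_univ, one_smul]
            ring_nf
          -- The integrand is nonnegative because it dominates the trace of an even power of a Gram
          -- matrix whose head column is w.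
          · filter_upwards [(hν 0).bounded] with w hw
            have h := trace_shrinkGram_pow_succ_le ht htK j a (Fin.cons w v) (ha 0)
              (le_trans (mul_le_mul_of_nonneg_left (dotProduct_self_le_of_abs_le hw) (ha 0))
                (haK 0)) hj
            rw [← hc] at h
            exact (trace_shrinkGram_pow_nonneg hj).trans h
      _ ≤ ENNReal.ofReal (1 - c * a 0) *
            ENNReal.ofReal (n * ∏ l : Fin k, (1 - c * a l.succ)) := by
          have hm : Measurable fun v => ENNReal.ofReal (trace (G v)) :=
            ENNReal.measurable_ofReal.comp hGc.matrix_trace.measurable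
          rw [lintegral_const_mul _ hm]
          gcongr
          exact ih (Fin.tail a) _ (fun l => hν _) (fun l => ha _) (fun l => hca _) (fun l => haK _)
      _ = _ := by
          rw [← ENNReal.ofReal_mul (sub_nonneg.2 (hca 0)), Fin.prod_univ_succ]
          ring_nf

/-- The Chernoff bound for the smallest eigenvalue of `∑ₗ f(hₗ) vₗ vₗᵀ` with independent
bounded isotropic columns `vₗ` and independent weights. -/
theorem measure_exists_quadratic_le (hK : 0 < K) {f : ℝ → ℝ} (hf : Continuous f)
    (hf0 : ∀ x, 0 ≤ f x) (hfK : ∀ x, f x * (D ^ 2 * n) ≤ K) (hf1 : ∀ x, f x ≤ 4 * K)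
    (η : Measure ℝ) [IsProbabilityMeasure η] (ν : Fin k → Measure (Fin n → ℝ))
    (hν : ∀ l, IsColumnLaw D (ν l)) (s : ℝ) :
    ((Measure.pi ν).prod (Measure.pi fun _ : Fin k => η))
      {z | ∃ x : Fin n → ℝ, ‖WithLp.toLp 2 x‖ = 1 ∧ ∑ l, f (z.2 l) * (z.1 l ⬝ᵥ x) ^ 2 ≤ s} *
        ENNReal.ofReal (Real.exp (-(s / (2 * K)))) ≤
      ENNReal.ofReal (n * Real.exp (-(k * (∫ x, f x ∂η) / (4 * K)))) := by
  have := fun l => (hν l).prob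
  set Q := (Measure.pi ν).prod (Measure.pi fun _ : Fin k => η)
  set bad := {z : (Fin k → Fin n → ℝ) × (Fin k → ℝ) |
    ∃ x : Fin n → ℝ, ‖WithLp.toLp 2 x‖ = 1 ∧ ∑ l, f (z.2 l) * (z.1 l ⬝ᵥ x) ^ 2 ≤ s}
  -- The trace of the 2^j-th power of the Gram matrix has total exponent N = 2^(j+1) in the factors.
  -- The step T is fixed by N T K = 1/2, so N T (1 - N T K) = 1/(4K) for every j.
  set N : ℕ → ℕ := fun j => 2 ^ (j + 1) with hN
  set T : ℕ → ℝ := fun j => 1 / (2 * K * N j) with hT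
  set b : ℕ → ℝ := fun j => 1 - T j * s - (k * (T j * K)) ^ 2 with hb
  have hNpos : ∀ j, (0 : ℝ) < N j := fun j => by simp [hN]
  have hNT : ∀ j, N j * T j * K = 1 / 2 := fun j => by
    have := hNpos j
    simp only [hT]
    field_simp
  have hNtop : Filter.Tendsto N Filter.atTop Filter.atTop :=
    (tendsto_pow_atTop_atTop_of_one_lt one_lt_two).comp (Filter.tendsto_add_atTop_nat 1)
  have hfi : Integrable f η := by
    refine Integrable.of_bound (C := 4 * K) hf.aestronglyMeasurable (ae_of_all _ fun x => ?_)
    rw [Real.norm_eq_abs, abs_of_nonneg (hf0 x)]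
    exact hf1 x
  have hg1 : ∀ x, 0 ≤ 1 - 1 / (4 * K) * f x := fun x => by
    have := hf1 x
    rw [sub_nonneg, one_div_mul_eq_div, div_le_one (by positivity)]
    exact this
  -- The first-order term of N (b - 1) is exactly -s/(2K); the quadratic error is (k/2)²/N and
  -- disappears.
  have hlim : Filter.Tendsto (fun j => b j ^ N j) Filter.atTop (nhds (Real.exp (-(s / (2 * K))))) := by
    have h := Real.tendsto_one_add_pow_exp_of_tendsto (g := fun N : ℕ =>
      -(1 / (2 * K * N) * s) - (k * (1 / (2 * K * N) * K)) ^ 2) (t := -(s / (2 * K))) ?_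
    · refine (h.comp hNtop).congr fun j => ?_
      simp only [Function.comp, hb, hT]
      ring
    · have h2 : Filter.Tendsto (fun N : ℕ => -(s / (2 * K)) - ((k : ℝ) / 2) ^ 2 * (1 / (N : ℝ)))
          Filter.atTop (nhds (-(s / (2 * K)) - ((k : ℝ) / 2) ^ 2 * 0)) :=
        tendsto_const_nhds.sub (tendsto_one_div_atTop_nhds_zero_nat.const_mul _)
      rw [mul_zero, sub_zero] at h2
      refine h2.congr' ?_
      filter_upwards [Filter.eventually_gt_atTop 0] with N hN0
      have : (0 : ℝ) < N := by exact_mod_cast hN0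
      field_simp
  have hblim : Filter.Tendsto b Filter.atTop (nhds 1) := by
    have h1 : Filter.Tendsto T Filter.atTop (nhds 0) := by
      have : Filter.Tendsto (fun j => 2 * K * (N j : ℝ)) Filter.atTop Filter.atTop :=
        (tendsto_natCast_atTop_atTop.comp hNtop).const_mul_atTop (by positivity)
      exact this.inv_tendsto_atTop.congr fun j => by simp only [hT, Pi.inv_apply, one_div]
    have h2 : Filter.Tendsto b Filter.atTop (nhds (1 - 0 * s - (k * (0 * K)) ^ 2)) :=
      (tendsto_const_nhds.sub (h1.mul_const s)).sub (((h1.mul_const K).const_mul _).pow 2)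
    simpa using h2
  have hkey : ∀ᶠ j in Filter.atTop, Q bad * ENNReal.ofReal (b j ^ N j) ≤
      ENNReal.ofReal (n * Real.exp (-(k * (∫ x, f x ∂η) / (4 * K)))) := by
    filter_upwards [Filter.eventually_ge_atTop 1, hblim.eventually (lt_mem_nhds one_pos)]
      with j hj hbj
    have hT0 : 0 ≤ T j := by
      have := hNpos j
      simp only [hT]; positivity
    have hTK : T j * K ≤ 1 := by
      have h1 : (1 : ℝ) ≤ N j := by exact_mod_cast Nat.one_le_two_pow
      have := hNT j
      nlinarith [mul_nonneg hT0 hK.le]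
    set H : (Fin k → Fin n → ℝ) × (Fin k → ℝ) → ℝ≥0∞ := fun z =>
      ENNReal.ofReal (trace (shrinkGram (T j) k (fun l => f (z.2 l)) z.1 ^ 2 ^ j)) with hH
    have hHm : Measurable H := by
      refine ENNReal.measurable_ofReal.comp (Continuous.measurable ?_)
      have h1 : Continuous fun z : (Fin k → Fin n → ℝ) × (Fin k → ℝ) =>
          ((fun l => f (z.2 l), z.1) : (Fin k → ℝ) × (Fin k → Fin n → ℝ)) := by fun_prop
      exact (((continuous_shrinkGram (T j) k).comp h1).pow _).matrix_trace
    have hae : ∀ᵐ z ∂Q, ∀ l i, |z.1 l i| ≤ D := by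
      refine Measure.quasiMeasurePreserving_fst.ae (p := fun v : Fin k → Fin n → ℝ => ∀ l i, |v l i| ≤ D) ?_
      exact ae_all_iff.2 fun l => (Measure.quasiMeasurePreserving_eval ν l).ae (hν l).bounded
    -- The bad set need not be measurable, so it is enlarged to a superlevel set of the trace before
    -- Markov's inequality is used.
    have h1 : Q bad ≤ Q {z | ENNReal.ofReal (b j ^ N j) ≤ H z} := by
      refine measure_mono_ae ?_
      filter_upwards [hae] with z hz hzb
      obtain ⟨x, hx, hxs⟩ := hzb
      refine ENNReal.ofReal_le_ofReal ?_
      exact le_trace_shrinkGram_pow hT0 hTK hK.le (fun l => hf0 _) (fun l =>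
        (mul_le_mul_of_nonneg_left (dotProduct_self_le_of_abs_le (hz l)) (hf0 _)).trans (hfK _))
        hx hxs hj hbj.le
    have h2 : ENNReal.ofReal (b j ^ N j) * Q {z | ENNReal.ofReal (b j ^ N j) ≤ H z} ≤
        ∫⁻ z, H z ∂Q := mul_meas_ge_le_lintegral₀ hHm.aemeasurable _
    have hc : 1 / (4 * K) = (2 ^ (j + 1) : ℕ) * T j * (1 - (2 ^ (j + 1) : ℕ) * T j * K) := by
      have h3 := hNT j
      have h4 : N j * T j = 1 / (2 * K) := by
        field_simp
        field_simp at h3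
        linarith
      change _ = (N j : ℝ) * T j * (1 - N j * T j * K)
      rw [h3, h4]
      field_simp
      norm_num
    have h3 : ∫⁻ z, H z ∂Q ≤ ∫⁻ h, ENNReal.ofReal (n * ∏ l, (1 - 1 / (4 * K) * f (h l)))
        ∂(Measure.pi fun _ : Fin k => η) := by
      rw [lintegral_prod_symm' _ hHm]
      refine lintegral_mono fun h => ?_
      exact lintegral_trace_shrinkGram_pow_le hT0 hTK hj hc k (fun l => f (h l)) ν hν
        (fun l => hf0 _) (fun l => sub_nonneg.1 (hg1 _)) (fun l => hfK _)
    have h4 : ∫⁻ h, ENNReal.ofReal (n * ∏ l, (1 - 1 / (4 * K) * f (h l)))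
        ∂(Measure.pi fun _ : Fin k => η) = ENNReal.ofReal (n * (1 - 1 / (4 * K) * ∫ x, f x ∂η) ^ k) := by
      have hi : Integrable (fun x => 1 - 1 / (4 * K) * f x) η :=
        (integrable_const _).sub (hfi.const_mul _)
      rw [← ofReal_integral_eq_lintegral_ofReal, integral_const_mul,
        integral_fintype_prod_eq_pow (fun x => 1 - 1 / (4 * K) * f x),
        integral_sub (integrable_const _) (hfi.const_mul _), integral_const_mul]
      · simp
      · exact (Integrable.fintype_prod fun _ => hi).const_mul _
      · exact ae_of_all _ fun h => mul_nonneg (Nat.cast_nonneg _)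
          (Finset.prod_nonneg fun l _ => hg1 _)
    have h5 : (1 - 1 / (4 * K) * ∫ x, f x ∂η) ^ k ≤
        Real.exp (-(k * (∫ x, f x ∂η) / (4 * K))) := by
      have h6 : 0 ≤ 1 - 1 / (4 * K) * ∫ x, f x ∂η := by
        have : ∫ x, f x ∂η ≤ 4 * K := by
          have := integral_mono hfi (integrable_const (μ := η) (4 * K)) hf1
          simpa using this
        rwa [sub_nonneg, one_div_mul_eq_div, div_le_one (by positivity)]
      calc (1 - 1 / (4 * K) * ∫ x, f x ∂η) ^ k
          ≤ Real.exp (-(1 / (4 * K) * ∫ x, f x ∂η)) ^ k := by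
            gcongr
            exact Real.one_sub_le_exp_neg _
        _ = _ := by
            rw [← Real.exp_nat_mul]
            congr 1
            ring
    calc Q bad * ENNReal.ofReal (b j ^ N j)
        ≤ ENNReal.ofReal (b j ^ N j) * Q {z | ENNReal.ofReal (b j ^ N j) ≤ H z} := by
          rw [mul_comm]; gcongr
      _ ≤ _ := h2
      _ ≤ _ := h3
      _ = _ := h4
      _ ≤ _ := by gcongr
  exact le_of_tendsto (ENNReal.Tendsto.const_mul (ENNReal.tendsto_ofReal hlim)
    (Or.inr (measure_ne_top _ _))) hkey

end Chernoff

/-! ### Sub-Gaussian tails of the network output -/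

section Tail

variable {n k : ℕ} {D a : ℝ}

lemma lintegral_pi_prod {E : Type*} [MeasurableSpace E] {k : ℕ} (ν : Fin k → Measure E)
    [∀ l, IsProbabilityMeasure (ν l)] {f : Fin k → E → ℝ≥0∞} (hf : ∀ l, Measurable (f l)) :
    ∫⁻ v, ∏ l, f l (v l) ∂(Measure.pi ν) = ∏ l, ∫⁻ w, f l w ∂(ν l) := by
  have h := lintegral_prod_eq_prod_lintegral_of_indepFun (μ := Measure.pi ν) Finset.univ
    (fun l v => f l (v l)) (iIndepFun_pi fun l => (hf l).aemeasurable)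
    (fun l => (hf l).comp (measurable_pi_apply l))
  rw [h]
  exact Finset.prod_congr rfl fun l _ => (measurePreserving_eval ν l).lintegral_comp (hf l)

lemma IsColumnLaw.lintegral_exp_le {ν : Measure (Fin n → ℝ)} (hν : IsColumnLaw D ν) (hD : 0 ≤ D)
    (i : Fin n) (r : ℝ) :
    ∫⁻ v, ENNReal.ofReal (Real.exp (r * v i)) ∂ν ≤
      ENNReal.ofReal (min (Real.exp (r ^ 2 * D ^ 2 / 2)) (Real.exp (|r| * D))) := by
  have := hν.prob
  have hb : ∀ᵐ v ∂ν, v i ∈ Set.Icc (-D) D := by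
    filter_upwards [hν.bounded] with v hv using abs_le.1 (hv i)
  have h := hasSubgaussianMGF_of_mem_Icc_of_integral_eq_zero
    (X := fun v : Fin n → ℝ => v i) (μ := ν) (measurable_pi_apply i).aemeasurable hb (hν.centered i)
  rw [← ofReal_integral_eq_lintegral_ofReal (h.integrable_exp_mul r)
    (ae_of_all _ fun v => (Real.exp_pos _).le)]
  refine ENNReal.ofReal_le_ofReal (le_min ?_ ?_)
  · refine (h.mgf_le r).trans (Real.exp_le_exp.2 (le_of_eq ?_))
    have : ((‖D - -D‖₊ : ℝ≥0) : ℝ) = 2 * D := by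
      rw [coe_nnnorm, Real.norm_eq_abs, abs_of_nonneg (by linarith)]; ring
    push_cast
    rw [← coe_nnnorm, this]
    ring
  · have h2 : ∀ᵐ v ∂ν, Real.exp (r * v i) ≤ Real.exp (|r| * D) := by
      filter_upwards [hν.bounded] with v hv
      refine Real.exp_le_exp.2 ((le_abs_self _).trans ?_)
      rw [abs_mul]
      exact mul_le_mul_of_nonneg_left (hv i) (abs_nonneg _)
    simpa using integral_mono_ae (h.integrable_exp_mul r) (integrable_const _) h2

/-- The sub-Gaussian constant of `v φ(h)` for `v` centered and bounded by `D` and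
`M = E exp(a φ(h)²)`. -/
noncomputable def subgaussConst (D a M : ℝ) : ℝ := D ^ 2 / (4 * a) + D ^ 2 * (M - 1) / (2 * a)

/-- Averaging exp(s²x²D²/2) may diverge for large s, so two regimes are needed. For small s,
convexity of exp interpolates between 0 and a x²; for large s, Young's inequality splits |s x| D
into a term in s² plus a x². -/
lemma min_exp_le (ha : 0 < a) (s x : ℝ) :
    min (Real.exp ((s * x) ^ 2 * D ^ 2 / 2)) (Real.exp (|s * x| * D)) ≤
      if s ^ 2 * D ^ 2 / (2 * a) ≤ 1 then
        1 + s ^ 2 * D ^ 2 / (2 * a) * (Real.exp (a * x ^ 2) - 1)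
      else Real.exp (s ^ 2 * D ^ 2 / (4 * a)) * Real.exp (a * x ^ 2) := by
  split_ifs with h
  · refine (min_le_left _ _).trans ?_
    set r := s ^ 2 * D ^ 2 / (2 * a) with hr
    have hr0 : 0 ≤ r := by positivity
    have h1 := convexOn_exp.2 (Set.mem_univ 0) (Set.mem_univ (a * x ^ 2)) (sub_nonneg.2 h) hr0
      (by ring)
    simp only [smul_eq_mul, mul_zero, zero_add, Real.exp_zero, mul_one] at h1
    have e : (s * x) ^ 2 * D ^ 2 / 2 = r * (a * x ^ 2) := by rw [hr]; field_simp
    rw [e]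
    linarith
  · refine (min_le_right _ _).trans ?_
    rw [← Real.exp_add]
    refine Real.exp_le_exp.2 ?_
    rw [abs_mul]
    have h1 : 0 ≤ (|s| * D / 2 - a * |x|) ^ 2 / a := by positivity
    have e : (|s| * D / 2 - a * |x|) ^ 2 / a =
        s ^ 2 * D ^ 2 / (4 * a) + a * x ^ 2 - |s| * |x| * D := by
      rw [← sq_abs s, ← sq_abs x]
      field_simp
      ring
    linarith

/-- Both regimes fit one Gaussian-type bound because κs² = r/2 + r(M - 1): for r ≤ 1 use 1 + z ≤ exp
z, for r > 1 use M ≤ exp(M - 1) ≤ exp(r(M - 1)). -/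
lemma lintegral_exp_column_mul_le {ν : Measure (Fin n → ℝ)} (hν : IsColumnLaw D ν) (hD : 0 ≤ D)
    {η : Measure ℝ} [IsProbabilityMeasure η] {φ : ℝ → ℝ} (ha : 0 < a)
    (hint : Integrable (fun x => Real.exp (a * φ x ^ 2)) η) (i : Fin n) (s : ℝ) :
    ∫⁻ x, ∫⁻ v, ENNReal.ofReal (Real.exp (s * (v i * φ x))) ∂ν ∂η ≤
      ENNReal.ofReal (Real.exp (subgaussConst D a (∫ x, Real.exp (a * φ x ^ 2) ∂η) * s ^ 2)) := by
  set M := ∫ x, Real.exp (a * φ x ^ 2) ∂η with hM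
  have hM1 : 1 ≤ M := by
    have h := integral_mono (integrable_const (μ := η) (1 : ℝ)) hint
      (fun x => Real.one_le_exp (by positivity))
    simpa using h
  set r := s ^ 2 * D ^ 2 / (2 * a) with hr
  have hr0 : 0 ≤ r := by positivity
  have hκ : subgaussConst D a M * s ^ 2 = r / 2 + r * (M - 1) := by
    rw [subgaussConst, hr]; field_simp; ring
  have h1 : ∀ x, ∫⁻ v, ENNReal.ofReal (Real.exp (s * (v i * φ x))) ∂ν ≤ ENNReal.ofReal
      (if r ≤ 1 then 1 + r * (Real.exp (a * φ x ^ 2) - 1)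
        else Real.exp (s ^ 2 * D ^ 2 / (4 * a)) * Real.exp (a * φ x ^ 2)) := fun x => by
    have e : ∀ v : Fin n → ℝ, s * (v i * φ x) = s * φ x * v i := fun v => by ring
    simp only [e]
    exact (hν.lintegral_exp_le hD i (s * φ x)).trans
      (ENNReal.ofReal_le_ofReal (min_exp_le ha s (φ x)))
  refine (lintegral_mono h1).trans ?_
  rw [hκ]
  split_ifs with h
  · have hi : Integrable (fun x => 1 + r * (Real.exp (a * φ x ^ 2) - 1)) η :=
      (integrable_const _).add ((hint.sub (integrable_const _)).const_mul _)
    rw [← ofReal_integral_eq_lintegral_ofReal hi]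
    · refine ENNReal.ofReal_le_ofReal ?_
      have e : ∫ x, (1 + r * (Real.exp (a * φ x ^ 2) - 1)) ∂η = 1 + r * (M - 1) := by
        have hs : Integrable (fun x => Real.exp (a * φ x ^ 2) - 1) η :=
          hint.sub (integrable_const _)
        rw [integral_add (integrable_const _) (hs.const_mul _),
          integral_const_mul, integral_sub hint (integrable_const _)]
        simp [hM]
      rw [e]
      have := Real.add_one_le_exp (r / 2 + r * (M - 1))
      linarith
    · refine ae_of_all _ fun x => ?_
      have : 1 ≤ Real.exp (a * φ x ^ 2) := Real.one_le_exp (by positivity)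
      have := mul_nonneg hr0 (sub_nonneg.2 this)
      simp only [Pi.zero_apply]
      linarith
  · rw [← ofReal_integral_eq_lintegral_ofReal (hint.const_mul _)
      (ae_of_all _ fun x => by positivity), integral_const_mul, ← hM]
    refine ENNReal.ofReal_le_ofReal ?_
    have e : s ^ 2 * D ^ 2 / (4 * a) = r / 2 := by rw [hr]; field_simp; ring
    rw [e, Real.exp_add]
    gcongr
    have h2 := Real.add_one_le_exp (M - 1)
    have h3 : M - 1 ≤ r * (M - 1) := le_mul_of_one_le_left (by linarith) (not_le.1 h).le
    have := Real.exp_le_exp.2 h3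
    linarith

/-- The `i`-th output of the network in terms of the columns of `V` and of `h = W u`. -/
noncomputable def output (φ : ℝ → ℝ) (i : Fin n) (z : (Fin k → Fin n → ℝ) × (Fin k → ℝ)) : ℝ :=
  1 / √(k : ℝ) * ∑ l, z.1 l i * φ (z.2 l)

lemma measurable_output {φ : ℝ → ℝ} (hφ : Continuous φ) (i : Fin n) :
    Measurable (output (k := k) φ i) := by
  unfold output
  fun_prop

lemma lintegral_exp_output_le (hk : 1 ≤ k) {ν : Fin k → Measure (Fin n → ℝ)}
    (hν : ∀ l, IsColumnLaw D (ν l)) (hD : 0 ≤ D) {η : Measure ℝ} [IsProbabilityMeasure η]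
    {φ : ℝ → ℝ} (hφ : Continuous φ) (ha : 0 < a)
    (hint : Integrable (fun x => Real.exp (a * φ x ^ 2)) η) (i : Fin n) (s : ℝ) :
    ∫⁻ z, ENNReal.ofReal (Real.exp (s * output φ i z))
        ∂((Measure.pi ν).prod (Measure.pi fun _ : Fin k => η)) ≤
      ENNReal.ofReal (Real.exp (subgaussConst D a (∫ x, Real.exp (a * φ x ^ 2) ∂η) * s ^ 2)) := by
  have := fun l => (hν l).prob
  have hk0 : (0 : ℝ) < k := by exact_mod_cast hk
  set κ := subgaussConst D a (∫ x, Real.exp (a * φ x ^ 2) ∂η)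
  have hm := measurable_output (k := k) hφ i
  rw [lintegral_prod_symm' _ (by fun_prop)]
  have e1 : ∀ (h : Fin k → ℝ) (v : Fin k → Fin n → ℝ),
      ENNReal.ofReal (Real.exp (s * output φ i (v, h))) =
      ∏ l, ENNReal.ofReal (Real.exp (s / √k * (v l i * φ (h l)))) := fun h v => by
    rw [← ENNReal.ofReal_prod_of_nonneg fun l _ => (Real.exp_pos _).le, ← Real.exp_sum,
      ← Finset.mul_sum, output]
    ring_nf
  have hm2 : Measurable fun p : ℝ × (Fin n → ℝ) =>
      ENNReal.ofReal (Real.exp (s / √k * (p.2 i * φ p.1))) := by fun_prop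
  have e2 : ∀ h : Fin k → ℝ, ∫⁻ v, ENNReal.ofReal (Real.exp (s * output φ i (v, h)))
      ∂(Measure.pi ν) =
      ∏ l, ∫⁻ w, ENNReal.ofReal (Real.exp (s / √k * (w i * φ (h l)))) ∂(ν l) := fun h => by
    simp only [e1]
    exact lintegral_pi_prod ν
      (f := fun l w => ENNReal.ofReal (Real.exp (s / √k * (w i * φ (h l))))) (by fun_prop)
  simp only [e2]
  rw [lintegral_pi_prod (fun _ => η)
    (f := fun l x => ∫⁻ w, ENNReal.ofReal (Real.exp (s / √k * (w i * φ x))) ∂(ν l))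
    (fun l => hm2.lintegral_prod_right')]
  refine (Finset.prod_le_prod' fun l _ =>
    lintegral_exp_column_mul_le (hν l) hD ha hint i (s / √k)).trans ?_
  rw [Finset.prod_const, Finset.card_univ, Fintype.card_fin, ← ENNReal.ofReal_pow (Real.exp_pos _).le,
    ← Real.exp_nat_mul]
  refine ENNReal.ofReal_le_ofReal (Real.exp_le_exp.2 (le_of_eq ?_))
  rw [div_pow, Real.sq_sqrt hk0.le]
  change k * (κ * (s ^ 2 / k)) = κ * s ^ 2
  field_simp

lemma lintegral_exp_mul_gaussianReal (t : ℝ) :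
    ∫⁻ x, ENNReal.ofReal (Real.exp (t * x)) ∂(gaussianReal 0 1) =
      ENNReal.ofReal (Real.exp (t ^ 2 / 2)) := by
  rw [← ofReal_integral_eq_lintegral_ofReal (integrable_exp_mul_gaussianReal t)
    (ae_of_all _ fun x => (Real.exp_pos _).le)]
  have := congrFun (mgf_fun_id_gaussianReal (μ := 0) (v := 1)) t
  simp only [mgf] at this
  rw [this]
  simp

lemma integrable_exp_sq_div_four_gaussianReal :
    Integrable (fun x : ℝ => Real.exp (x ^ 2 / 4)) (gaussianReal 0 1) := by
  rw [gaussianReal_of_var_ne_zero _ one_ne_zero, gaussianPDF_def,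
    integrable_withDensity_iff_integrable_smul₀' (by fun_prop) (by simp)]
  have h := (integrable_exp_neg_mul_sq (b := 1 / 4) (by norm_num)).const_mul (√(2 * Real.pi * 1))⁻¹
  refine h.congr (ae_of_all _ fun x => ?_)
  beta_reduce
  rw [smul_eq_mul, ENNReal.toReal_ofReal (gaussianPDFReal_nonneg _ _ _), gaussianPDFReal,
    NNReal.coe_one, mul_assoc (√(2 * Real.pi * 1))⁻¹, ← Real.exp_add]
  congr 2
  ring

/-- Gaussian linearization: exp(X²/(8κ)) is the average of exp(rXg) over a standard Gaussian g with
r² = 1/(4κ). After exchanging the integrals, the assumed bound leaves exp(g²/4). -/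
lemma lintegral_exp_sq_le_of_mgf_le {Ω : Type*} [MeasurableSpace Ω] {Q : Measure Ω}
    [IsProbabilityMeasure Q] {X : Ω → ℝ} (hX : Measurable X) {κ : ℝ} (hκ : 0 < κ)
    (h : ∀ s, ∫⁻ z, ENNReal.ofReal (Real.exp (s * X z)) ∂Q ≤
      ENNReal.ofReal (Real.exp (κ * s ^ 2))) :
    ∫⁻ z, ENNReal.ofReal (Real.exp (X z ^ 2 / (8 * κ))) ∂Q ≤
      ENNReal.ofReal (∫ x, Real.exp (x ^ 2 / 4) ∂(gaussianReal 0 1)) := by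
  set r := √(1 / (4 * κ)) with hr
  have hr2 : r ^ 2 = 1 / (4 * κ) := Real.sq_sqrt (by positivity)
  have e1 : ∀ z, ENNReal.ofReal (Real.exp (X z ^ 2 / (8 * κ))) =
      ∫⁻ x, ENNReal.ofReal (Real.exp (r * X z * x)) ∂(gaussianReal 0 1) := fun z => by
    rw [lintegral_exp_mul_gaussianReal, mul_pow, hr2]
    congr 2
    field_simp
    ring
  simp only [e1]
  rw [lintegral_lintegral_swap (by fun_prop), ofReal_integral_eq_lintegral_ofReal
    integrable_exp_sq_div_four_gaussianReal (ae_of_all _ fun x => (Real.exp_pos _).le)]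
  refine lintegral_mono fun x => ?_
  have h2 := h (r * x)
  have e2 : κ * (r * x) ^ 2 = x ^ 2 / 4 := by rw [mul_pow, hr2]; field_simp
  rw [e2] at h2
  refine le_trans (le_of_eq (lintegral_congr fun z => ?_)) h2
  ring_nf

lemma one_le_integral_exp_sq : 1 ≤ ∫ x : ℝ, Real.exp (x ^ 2 / 4) ∂(gaussianReal 0 1) := by
  have h := integral_mono (integrable_const (μ := gaussianReal 0 1) (1 : ℝ))
    integrable_exp_sq_div_four_gaussianReal (fun x => Real.one_le_exp (by positivity))
  simpa using h

/-- Tail bound for the norm of a vector with uniformly sub-Gaussian (possibly dependent)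
coordinates. -/
lemma measure_lt_sum_sq_le {Ω : Type*} [MeasurableSpace Ω] {Q : Measure Ω}
    [IsProbabilityMeasure Q] (hn : 1 ≤ n) {X : Fin n → Ω → ℝ} (hX : ∀ i, Measurable (X i))
    {κ : ℝ} (hκ : 0 < κ)
    (h : ∀ i s, ∫⁻ z, ENNReal.ofReal (Real.exp (s * X i z)) ∂Q ≤
      ENNReal.ofReal (Real.exp (κ * s ^ 2))) {C : ℝ} {d : ℕ} (hd : 2 ≤ d)
    (hC1 : 8 * κ ≤ C ^ 2) (hC : ∫ x, Real.exp (x ^ 2 / 4) ∂(gaussianReal 0 1) ≤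
      Real.exp ((C ^ 2 / (8 * κ) - 1) * Real.log 2)) :
    Q {z | C ^ 2 * (n * Real.log d) < ∑ i, X i z ^ 2} ≤ ENNReal.ofReal (1 / d) := by
  set M := ∫ x, Real.exp (x ^ 2 / 4) ∂(gaussianReal 0 1)
  have hn0 : (0 : ℝ) < n := by exact_mod_cast hn
  have hd0 : (0 : ℝ) < d := by exact_mod_cast (by omega : 0 < d)
  set Y : Ω → ℝ := fun z => Real.exp (∑ i, (1 / n : ℝ) * (X i z ^ 2 / (8 * κ))) with hY
  have hYm : Measurable Y := by fun_prop
  -- Jensen over the coordinates makes independence between them unnecessary.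
  have h1 : ∀ z, Y z ≤ ∑ i, (1 / n : ℝ) * Real.exp (X i z ^ 2 / (8 * κ)) := fun z => by
    have := convexOn_exp.map_sum_le (t := Finset.univ) (w := fun _ : Fin n => (1 / n : ℝ))
      (p := fun i => X i z ^ 2 / (8 * κ)) (fun _ _ => by positivity)
      (by simp [hn0.ne']) (fun _ _ => Set.mem_univ _)
    simpa only [smul_eq_mul] using this
  have h2 : ∫⁻ z, ENNReal.ofReal (Y z) ∂Q ≤ ENNReal.ofReal M := by
    calc ∫⁻ z, ENNReal.ofReal (Y z) ∂Q
        ≤ ∫⁻ z, ∑ i, ENNReal.ofReal (1 / n) * ENNReal.ofReal (Real.exp (X i z ^ 2 / (8 * κ))) ∂Q := by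
          refine lintegral_mono fun z => (ENNReal.ofReal_le_ofReal (h1 z)).trans ?_
          rw [ENNReal.ofReal_sum_of_nonneg fun i _ => by positivity]
          exact le_of_eq (Finset.sum_congr rfl fun i _ => ENNReal.ofReal_mul (by positivity))
      _ = ∑ i, ENNReal.ofReal (1 / n) * ∫⁻ z, ENNReal.ofReal (Real.exp (X i z ^ 2 / (8 * κ))) ∂Q := by
          rw [lintegral_finsetSum _ fun i _ => by fun_prop]
          exact Finset.sum_congr rfl fun i _ => lintegral_const_mul _ (by fun_prop)
      _ ≤ ∑ _i : Fin n, ENNReal.ofReal (1 / n) * ENNReal.ofReal M := by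
          gcongr with i
          exact lintegral_exp_sq_le_of_mgf_le (hX i) hκ (h i)
      _ = ENNReal.ofReal M := by
          rw [Finset.sum_const, Finset.card_univ, Fintype.card_fin, nsmul_eq_mul, ← mul_assoc,
            ← ENNReal.ofReal_natCast, ← ENNReal.ofReal_mul hn0.le, mul_one_div_cancel hn0.ne']
          simp
  set θ := C ^ 2 / (8 * κ) with hθ
  have hθ1 : 1 ≤ θ := (one_le_div (by positivity)).2 hC1
  have h3 : Q {z | C ^ 2 * (n * Real.log d) < ∑ i, X i z ^ 2} ≤
      Q {z | ENNReal.ofReal (Real.exp (θ * Real.log d)) ≤ ENNReal.ofReal (Y z)} := by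
    refine measure_mono fun z hz => ENNReal.ofReal_le_ofReal (Real.exp_le_exp.2 ?_)
    rw [Set.mem_ofPred_eq] at hz
    rw [← Finset.mul_sum, ← Finset.sum_div, hθ]
    have e : C ^ 2 / (8 * κ) * Real.log d = 1 / n * (C ^ 2 * (n * Real.log d) / (8 * κ)) := by
      field_simp
    rw [e]
    gcongr
  have h4 : ENNReal.ofReal (Real.exp (θ * Real.log d)) *
      Q {z | ENNReal.ofReal (Real.exp (θ * Real.log d)) ≤ ENNReal.ofReal (Y z)} ≤
      ENNReal.ofReal M :=
    (mul_meas_ge_le_lintegral (by fun_prop) _).trans h2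
  -- The condition on C is posed at d = 2, which is the worst case since C²/(8κ) ≥ 1.
  have h5 : M ≤ Real.exp (θ * Real.log d) * (1 / d) := by
    refine hC.trans ?_
    have hl : Real.log 2 ≤ Real.log d := Real.log_le_log two_pos (by exact_mod_cast hd)
    have e : Real.exp (θ * Real.log d) * (1 / d) = Real.exp ((θ - 1) * Real.log d) := by
      rw [sub_mul, one_mul, Real.exp_sub, Real.exp_log hd0]
      ring
    rw [e]
    have := sub_nonneg.2 hθ1
    gcongr
  refine h3.trans ?_
  have h6 := h4.trans (ENNReal.ofReal_le_ofReal h5)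
  rw [ENNReal.ofReal_mul (Real.exp_pos _).le] at h6
  exact (ENNReal.mul_le_mul_iff_right (by simp [Real.exp_pos]) ENNReal.ofReal_ne_top).1 h6

end Tail

/-! ### Joint law of the columns and the preactivations -/

section Laws

/-- The preactivations `W u`. -/
def preact {k d : ℕ} (W : Weights k d) (u : EuclideanSpace ℝ (Fin d)) : Fin k → ℝ :=
  fun l => ∑ j, W (l, j) * u j

lemma continuous_preact {k d : ℕ} :
    Continuous fun p : Weights k d × EuclideanSpace ℝ (Fin d) => preact p.1 p.2 := by
  unfold preact
  fun_prop

/-- Compare characteristic functions: ⟨Wu, t⟩ = ⟨W, t ⊗ u⟩, and t ⊗ u has the norm of t. -/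
lemma map_preact_stdGaussian {k d : ℕ} {u : EuclideanSpace ℝ (Fin d)} (hu : ‖u‖ = 1) :
    (stdGaussian (Weights k d)).map (fun W => preact W u) =
      Measure.pi fun _ : Fin k => gaussianReal 0 1 := by
  have hm : Measurable fun W : Weights k d => preact W u :=
    (continuous_preact.comp (by fun_prop : Continuous fun W : Weights k d => (W, u))).measurable
  have h1 : ((stdGaussian (Weights k d)).map (fun W => preact W u)).map (WithLp.toLp 2) =
      (Measure.pi fun _ : Fin k => gaussianReal 0 1).map (WithLp.toLp 2) := by
    rw [map_pi_eq_stdGaussian, Measure.map_map (by fun_prop) hm]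
    have := Measure.isProbabilityMeasure_map (μ := stdGaussian (Weights k d))
      (f := WithLp.toLp 2 ∘ fun W : Weights k d => preact W u)
      ((WithLp.measurable_toLp 2 _).comp hm).aemeasurable
    refine Measure.ext_of_charFun (funext fun t => ?_)
    set s : Weights k d := WithLp.toLp 2 fun e => t e.1 * u e.2 with hs
    have h2 : charFun ((stdGaussian (Weights k d)).map (WithLp.toLp 2 ∘ fun W => preact W u)) t =
        charFun (stdGaussian (Weights k d)) s := by
      rw [charFun_apply, charFun_apply, integral_map
        ((WithLp.measurable_toLp 2 _).comp hm).aemeasurable (by fun_prop)]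
      refine integral_congr_ae (ae_of_all _ fun W => ?_)
      have : inner ℝ (WithLp.toLp 2 (preact W u)) t = inner ℝ W s := by
        simp only [PiLp.inner_apply, hs, preact, Fintype.sum_prod_type, RCLike.inner_apply,
          conj_trivial, Finset.mul_sum]
        exact Finset.sum_congr rfl fun l _ => Finset.sum_congr rfl fun j _ => by ring
      simp only [Function.comp, this]
    have h3 : ‖s‖ ^ 2 = ‖t‖ ^ 2 := by
      have hu2 : ∑ j, u j ^ 2 = 1 := by rw [← EuclideanSpace.real_norm_sq_eq, hu, one_pow]
      rw [EuclideanSpace.real_norm_sq_eq, EuclideanSpace.real_norm_sq_eq]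
      simp only [hs, Fintype.sum_prod_type, mul_pow, ← Finset.mul_sum, hu2, mul_one]
    rw [h2, charFun_stdGaussian, charFun_stdGaussian, ← Complex.ofReal_pow, ← Complex.ofReal_pow, h3]
  have h4 := congrArg (Measure.map (WithLp.ofLp : EuclideanSpace ℝ (Fin k) → Fin k → ℝ)) h1
  rw [Measure.map_map (by fun_prop) (by fun_prop), Measure.map_map (by fun_prop) (by fun_prop),
    Measure.map_map (by fun_prop) (by fun_prop)] at h4
  simpa [Function.comp_def] using h4

lemma uniformSphere_ae_norm_eq_one (d : ℕ) : ∀ᵐ x ∂(uniformSphere d), ‖x‖ = 1 := by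
  unfold uniformSphere
  refine (ae_map_iff measurable_subtype_coe.aemeasurable
    (measurableSet_eq_fun measurable_norm measurable_const)).2 (ae_of_all _ fun x => ?_)
  simp

variable {Ω : Type*} [MeasurableSpace Ω] {μ : Measure Ω} [IsProbabilityMeasure μ] {n k d : ℕ}
  {D : ℝ} {u : Ω → EuclideanSpace ℝ (Fin d)} {W : Ω → Weights k d}
  {V : Ω → Matrix (Fin n) (Fin k) ℝ}

omit [IsProbabilityMeasure μ] in
lemma IsInitialization.ae_norm_u (h : IsInitialization μ D u W V) : ∀ᵐ ω ∂μ, ‖u ω‖ = 1 := by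
  have := uniformSphere_ae_norm_eq_one d
  rw [← h.law_u] at this
  exact ae_of_ae_map h.measurable_u.aemeasurable this

omit [IsProbabilityMeasure μ] in
lemma IsInitialization.map_W (h : IsInitialization μ D u W V) :
    μ.map W = stdGaussian (Weights k d) := by
  have hW := h.measurable_W
  have h1 := h.indep_W.map_fun_eq_pi_map (fun e => by fun_prop)
  simp only [h.law_W] at h1
  rw [← map_pi_eq_stdGaussian, ← h1, Measure.map_map (by fun_prop) (by fun_prop)]
  rfl

/-- Given u, the law of Wu does not depend on the unit vector u; Fubini removes the conditioning. -/
lemma IsInitialization.map_preact (h : IsInitialization μ D u W V) :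
    μ.map (fun ω => preact (W ω) (u ω)) = Measure.pi fun _ : Fin k => gaussianReal 0 1 := by
  have hW := h.measurable_W
  have hu := h.measurable_u
  have := Measure.isProbabilityMeasure_map (μ := μ) hu.aemeasurable
  have := Measure.isProbabilityMeasure_map (μ := μ) hW.aemeasurable
  have h1 := (indepFun_iff_map_prod_eq_prod_map_map hW.aemeasurable hu.aemeasurable).1 h.indep_W_u
  have hc := (continuous_preact (k := k) (d := d)).measurable
  ext s hs
  have e : (fun ω => preact (W ω) (u ω)) = (fun p : Weights k d × EuclideanSpace ℝ (Fin d) =>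
      preact p.1 p.2) ∘ fun ω => (W ω, u ω) := rfl
  rw [e, ← Measure.map_map hc (hW.prodMk hu), h1, Measure.map_apply hc hs,
    Measure.prod_apply_symm (hc hs)]
  have h2 : ∀ᵐ x ∂(μ.map u), μ.map W ((fun w => (w, x)) ⁻¹' ((fun p : Weights k d ×
      EuclideanSpace ℝ (Fin d) => preact p.1 p.2) ⁻¹' s)) =
      (Measure.pi fun _ : Fin k => gaussianReal 0 1) s := by
    rw [h.law_u]
    filter_upwards [uniformSphere_ae_norm_eq_one d] with x hx
    rw [h.map_W, ← map_preact_stdGaussian hx, Measure.map_apply _ hs]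
    · rfl
    · exact hc.comp (by fun_prop : Measurable fun w : Weights k d => (w, x))
  rw [lintegral_congr_ae h2]
  simp

/-- The columns of `V`, indexed first by the hidden unit. -/
def columns (V : Matrix (Fin n) (Fin k) ℝ) : Fin k → Fin n → ℝ := fun l i => V i l

lemma IsInitialization.isColumnLaw (h : IsInitialization μ D u W V) (l : Fin k) :
    IsColumnLaw D (μ.map fun ω => columns (V ω) l) := by
  have hV := h.measurable_V
  have hm : Measurable fun ω => columns (V ω) l := measurable_pi_iff.2 fun i => hV i l
  refine ⟨Measure.isProbabilityMeasure_map hm.aemeasurable, ?_, fun i => ?_, fun i i' => ?_⟩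
  · rw [ae_map_iff hm.aemeasurable]
    · exact ae_all_iff.2 fun i => h.bounded_V i l
    · simp only [Set.ofPred_forall]
      exact MeasurableSet.iInter fun i => measurableSet_le (by fun_prop) (by fun_prop)
  · rw [integral_map hm.aemeasurable (measurable_pi_apply i).aestronglyMeasurable]
    exact h.centered_V i l
  · have hm2 : Measurable fun v : Fin n → ℝ => v i * v i' := by fun_prop
    rw [integral_map hm.aemeasurable hm2.aestronglyMeasurable]
    exact h.cov_V i i' l

/-- The columns of `V` and the preactivations are independent; the preactivations are iid standard
Gaussian. -/
theorem IsInitialization.map_columns_preact (h : IsInitialization μ D u W V) :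
    μ.map (fun ω => (columns (V ω), preact (W ω) (u ω))) =
      (Measure.pi fun l => μ.map fun ω => columns (V ω) l).prod
        (Measure.pi fun _ : Fin k => gaussianReal 0 1) := by
  have hV := h.measurable_V
  have hW := h.measurable_W
  have hu := h.measurable_u
  have hc := (continuous_preact (k := k) (d := d)).measurable
  have hcol : ∀ l, Measurable fun ω => columns (V ω) l := fun l => measurable_pi_iff.2 fun i => hV i l
  have hm1 : Measurable fun ω => columns (V ω) := measurable_pi_iff.2 hcol
  have hm2 : Measurable fun ω => preact (W ω) (u ω) := hc.comp (hW.prodMk hu)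
  have h1 : IndepFun (fun ω => columns (V ω)) (fun ω => preact (W ω) (u ω)) μ :=
    h.indep_V.comp (φ := fun (A : Fin n → Fin k → ℝ) (l : Fin k) (i : Fin n) => A i l)
      (by fun_prop) hc
  rw [(indepFun_iff_map_prod_eq_prod_map_map hm1.aemeasurable hm2.aemeasurable).1 h1, h.map_preact]
  congr 1
  exact h.indep_col.map_fun_eq_pi_map fun l => (hcol l).aemeasurable

end Laws

/-! ### Error bound from the Kurdyka-Łojasiewicz inequality -/

section KL

variable {m : ℕ}

/-- Along the direction -g the derivative is -‖g‖², while the descent rate is at most c‖g‖. -/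
lemma norm_gradient_le_or_eq_zero {E : Type*} [NormedAddCommGroup E] [InnerProductSpace ℝ E]
    [CompleteSpace E] {f : E → ℝ} {g x : E} (hf : HasGradientAt f g x) {c : ℝ}
    (h : ∀ᶠ w in nhds x, f x - c * ‖w - x‖ ≤ f w) : ‖g‖ ≤ c ∨ g = 0 := by
  by_cases hg : g = 0
  · exact Or.inr hg
  left
  have hline : HasDerivAt (fun s : ℝ => f (x - s • g)) (-(‖g‖ ^ 2)) 0 := by
    have h1 : HasDerivAt (fun s : ℝ => x - s • g) (-g) 0 := by
      simpa using ((hasDerivAt_id (0 : ℝ)).smul_const g).const_sub x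
    have hf' : HasFDerivAt f (InnerProductSpace.toDual ℝ E g) (x - (0 : ℝ) • g) := by
      simpa using hf.hasFDerivAt
    have h2 := hf'.comp_hasDerivAt (0 : ℝ) h1
    simpa [InnerProductSpace.toDual_apply_apply, Function.comp_def] using h2
  have hslope := hline.tendsto_slope_zero_right
  have hcont : Filter.Tendsto (fun s : ℝ => x - s • g) (nhdsWithin 0 (Set.Ioi 0)) (nhds x) := by
    have : Continuous fun s : ℝ => x - s • g := by fun_prop
    simpa using (this.tendsto 0).mono_left nhdsWithin_le_nhds
  have hge : ∀ᶠ s in nhdsWithin (0 : ℝ) (Set.Ioi 0),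
      -(c * ‖g‖) ≤ s⁻¹ • (f (x - (0 + s) • g) - f (x - (0 : ℝ) • g)) := by
    filter_upwards [hcont.eventually h, self_mem_nhdsWithin] with s hs hs0
    have hs0' : (0 : ℝ) < s := hs0
    have e : ‖x - s • g - x‖ = s * ‖g‖ := by
      rw [sub_sub_cancel_left, norm_neg, norm_smul, Real.norm_of_nonneg hs0'.le]
    rw [e] at hs
    rw [zero_add, zero_smul, sub_zero, smul_eq_mul, inv_mul_eq_div, le_div_iff₀ hs0']
    linarith
  have h3 := ge_of_tendsto hslope hge
  have hgpos := norm_pos_iff.2 hg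
  nlinarith

/-- The error bound implied by the Kurdyka-Łojasiewicz inequality when the minimizer is unique. -/
theorem KLInequality.norm_sub_le {L : EuclideanSpace ℝ (Fin m) → ℝ} {y : EuclideanSpace ℝ (Fin m)}
    (hL : IsLoss L y) {ψ : ℝ → ℝ} {r₀ : ℝ} (hψ : KLInequality L ψ r₀) (huniq : ∀ v, L v = 0 → v = y)
    {v : EuclideanSpace ℝ (Fin m)} (hv : L v < r₀) : ‖v - y‖ ≤ ψ (L v) := by
  have hL0 : ∀ w, 0 ≤ L w := fun w => hL.min_zero.2 ⟨w, rfl⟩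
  have hinf : ⨅ x, L x = 0 := hL.min_zero.csInf_eq
  have hLc : Continuous L := hL.contDiff.continuous
  have hψ0 : ∀ w, L w < r₀ → 0 ≤ ψ (L w) := fun w hw => by
    rw [← hψ.map_zero]
    exact hψ.strictMonoOn.monotoneOn ⟨le_rfl, hψ.pos⟩ ⟨hL0 w, hw⟩ (hL0 w)
  by_cases hv0 : L v = 0
  · simp [huniq v hv0, hL.obs_min, hψ.map_zero]
  suffices h : ∀ c ∈ Set.Ioo (0 : ℝ) 1, c * ‖v - y‖ ≤ ψ (L v) by
    have h1 : Filter.Tendsto (fun c : ℝ => c * ‖v - y‖) (nhdsWithin 1 (Set.Iio 1))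
        (nhds (1 * ‖v - y‖)) :=
      ((continuous_id.mul continuous_const).tendsto 1).mono_left nhdsWithin_le_nhds
    rw [one_mul] at h1
    refine le_of_tendsto h1 ?_
    filter_upwards [Ioo_mem_nhdsLT (zero_lt_one (α := ℝ))] with c hc using h c hc
  rintro c ⟨hc0, hc1⟩
  -- An Ekeland-type argument: a minimizer w of G is y, or else ψ∘L has slope at most c < 1 at w,
  -- against the Kurdyka-Łojasiewicz inequality.
  set G : EuclideanSpace ℝ (Fin m) → ℝ := fun w => ψ (L w) + c * ‖w - v‖ with hG
  set S := {w | L w ≤ L v} ∩ Metric.closedBall v (ψ (L v) / c) with hS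
  have hScomp : IsCompact S :=
    (isCompact_closedBall v _).inter_left (isClosed_le hLc continuous_const)
  have hvS : v ∈ S := ⟨(le_rfl : L v ≤ L v), Metric.mem_closedBall_self (div_nonneg (hψ0 v hv) hc0.le)⟩
  have hGc : ContinuousOn G S := by
    refine ContinuousOn.add (hψ.contOn.comp hLc.continuousOn fun w hw => ⟨hL0 w, ?_⟩) (by fun_prop)
    exact lt_of_le_of_lt hw.1 hv
  obtain ⟨w, hwS, hw⟩ := hScomp.exists_isMinOn ⟨v, hvS⟩ hGc
  have hwr : L w < r₀ := lt_of_le_of_lt hwS.1 hv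
  have hGv : G w ≤ ψ (L v) := by simpa [hG] using hw hvS
  -- The minimum over S is one over all of {L < r₀}: outside the ball the penalty alone exceeds ψ(L
  -- v), and outside the sublevel set ψ∘L does so by monotonicity.
  have hmin : ∀ x, L x < r₀ → G w ≤ G x := by
    intro x hx
    by_cases h1 : L x ≤ L v
    · by_cases h2 : x ∈ Metric.closedBall v (ψ (L v) / c)
      · exact hw ⟨h1, h2⟩
      · rw [Metric.mem_closedBall, dist_eq_norm, not_le, div_lt_iff₀ hc0] at h2
        have := hψ0 x hx
        simp only [hG] at hGv ⊢
        linarith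
    · have h2 := hψ.strictMonoOn.monotoneOn ⟨hL0 v, hv⟩ ⟨hL0 x, hx⟩ (not_le.1 h1).le
      have h3 : 0 ≤ c * ‖x - v‖ := by positivity
      refine hGv.trans ?_
      simp only [hG]
      linarith
  by_cases hw0 : L w = 0
  · have e := huniq w hw0
    rw [e] at hGv
    simp only [hG, hL.obs_min, hψ.map_zero, zero_add] at hGv
    rwa [norm_sub_rev]
  exfalso
  have hwpos : 0 < L w := lt_of_le_of_ne (hL0 w) (Ne.symm hw0)
  have hkl := hψ.ineq w (by rw [hinf]; exact hwpos) (by rw [hinf, zero_add]; exact hwr)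
  rw [hinf, sub_zero] at hkl
  have hgrad : HasGradientAt L (∇ L w) w :=
    ((hL.contDiff.differentiable one_ne_zero) w).hasGradientAt
  have hψd : HasDerivAt ψ (deriv ψ (L w)) (L w) :=
    ((hψ.contDiffOn.differentiableOn one_ne_zero).differentiableAt
      (Ioo_mem_nhds hwpos hwr)).hasDerivAt
  have hcomp : HasGradientAt (fun x => ψ (L x)) (deriv ψ (L w) • ∇ L w) w := by
    rw [hasGradientAt_iff_hasFDerivAt]
    have := hψd.comp_hasFDerivAt w hgrad.hasFDerivAt
    simpa [Function.comp_def] using this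
  have hloc : ∀ᶠ x in nhds w, ψ (L w) - c * ‖x - w‖ ≤ ψ (L x) := by
    filter_upwards [(isOpen_lt hLc continuous_const).mem_nhds hwr] with x hx
    have h1 := hmin x hx
    have h2 : ‖x - v‖ ≤ ‖x - w‖ + ‖w - v‖ := norm_sub_le_norm_sub_add_norm_sub _ _ _
    have h3 := mul_le_mul_of_nonneg_left h2 hc0.le
    simp only [hG] at h1
    linarith
  have hnn : deriv ψ (L w) ≤ |deriv ψ (L w)| := le_abs_self _
  have hnorm : ‖deriv ψ (L w) • ∇ L w‖ = |deriv ψ (L w)| * ‖∇ L w‖ := by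
    rw [norm_smul, Real.norm_eq_abs]
  have h1 : 1 ≤ ‖deriv ψ (L w) • ∇ L w‖ := by
    rw [hnorm]
    exact hkl.trans (mul_le_mul_of_nonneg_right hnn (norm_nonneg _))
  rcases norm_gradient_le_or_eq_zero hcomp hloc with h2 | h2
  · linarith
  · rw [h2, norm_zero] at h1
    linarith

end KL

/-! ### Smallest singular value from a lower bound on the adjoint -/

section Singular

variable {p q : Type*} [Fintype p] [Fintype q]

lemma sigmaMin_nonneg (T : EuclideanSpace ℝ p →L[ℝ] EuclideanSpace ℝ q) : 0 ≤ sigmaMin T := by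
  refine Real.sInf_nonneg ?_
  rintro r ⟨z, _, _, rfl⟩
  positivity

lemma sigmaMin_le_norm (T : EuclideanSpace ℝ p →L[ℝ] EuclideanSpace ℝ q) : sigmaMin T ≤ ‖T‖ := by
  unfold sigmaMin
  rcases Set.eq_empty_or_nonempty {r : ℝ | ∃ z ∈ Set.range T, z ≠ 0 ∧
    r = ‖ContinuousLinearMap.adjoint T z‖ / ‖z‖} with h | ⟨r, hr⟩
  · rw [h, Real.sInf_empty]
    exact norm_nonneg _
  · refine (csInf_le ⟨0, ?_⟩ hr).trans ?_
    · rintro r ⟨z, _, _, rfl⟩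
      positivity
    · obtain ⟨z, _, hz, rfl⟩ := hr
      rw [div_le_iff₀ (norm_pos_iff.2 hz), ← LinearIsometryEquiv.norm_map ContinuousLinearMap.adjoint T]
      exact ContinuousLinearMap.le_opNorm _ _

lemma surjective_of_le_norm_adjoint {T : EuclideanSpace ℝ p →L[ℝ] EuclideanSpace ℝ q} {σ : ℝ}
    (hσ : 0 < σ) (h : ∀ z, σ * ‖z‖ ≤ ‖ContinuousLinearMap.adjoint T z‖) :
    Function.Surjective T := by
  have h1 : T.rangeᗮ = ⊥ := by
    rw [ContinuousLinearMap.orthogonal_range, eq_bot_iff]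
    intro z hz
    have hz' : ContinuousLinearMap.adjoint T z = 0 := hz
    have h2 := h z
    rw [hz', norm_zero] at h2
    have h3 : ‖z‖ ≤ 0 := by
      by_contra hcon
      have := mul_pos hσ (not_le.1 hcon)
      linarith
    simpa using h3
  exact LinearMap.range_eq_top.1 (Submodule.orthogonal_eq_bot_iff.1 h1)

/-- A nonzero vector is required: over an empty set of quotients the infimum would default to 0. -/
lemma le_sigmaMin [Nonempty q] {T : EuclideanSpace ℝ p →L[ℝ] EuclideanSpace ℝ q} {σ : ℝ}
    (hσ : 0 < σ) (h : ∀ z, σ * ‖z‖ ≤ ‖ContinuousLinearMap.adjoint T z‖) : σ ≤ sigmaMin T := by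
  obtain ⟨z, hz⟩ := exists_ne (0 : EuclideanSpace ℝ q)
  refine le_csInf ⟨_, z, surjective_of_le_norm_adjoint hσ h z, hz, rfl⟩ ?_
  rintro r ⟨z, _, hz, rfl⟩
  rw [le_div_iff₀ (norm_pos_iff.2 hz)]
  exact h z

end Singular

/-! ### The network Jacobian: Lipschitz bound, spectrum, radius -/

section Network

open Matrix

variable {n k d : ℕ} {φ : ℝ → ℝ} {u : EuclideanSpace ℝ (Fin d)} {V : Matrix (Fin n) (Fin k) ℝ}

lemma network_apply (W : Weights k d) (i : Fin n) :
    network φ u V W i = output φ i (columns V, preact W u) := rfl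

/-- The preactivation of one hidden unit as a linear functional of the weights. -/
noncomputable def preactCLM (u : EuclideanSpace ℝ (Fin d)) (l : Fin k) : Weights k d →L[ℝ] ℝ :=
  ∑ j, u j • EuclideanSpace.proj (l, j)

lemma preactCLM_apply (W : Weights k d) (l : Fin k) : preactCLM u l W = preact W u l := by
  simp [preactCLM, preact, mul_comm]

lemma jacobian_apply (hφ : Differentiable ℝ φ) (W H : Weights k d) (i : Fin n) :
    jacobian φ u V W H i =
      1 / √(k : ℝ) * ∑ l, V i l * (deriv φ (preact W u l) * preact H u l) := by
  have hcoord : ∀ i, HasFDerivAt (fun W => network φ u V W i)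
      ((1 / √(k : ℝ)) • ∑ l, V i l • (deriv φ (preact W u l) • preactCLM u l)) W := by
    intro i
    have e : (fun W => network φ u V W i) =
        fun W => (1 / √(k : ℝ)) • ∑ l, V i l • φ (preactCLM u l W) := by
      funext W
      simp [network_apply, output, columns, preactCLM_apply]
    rw [e]
    have h1 : ∀ l, HasDerivAt φ (deriv φ (preact W u l)) (preactCLM u l W) := fun l => by
      rw [preactCLM_apply]
      exact (hφ _).hasDerivAt
    have h2 : ∀ l, HasFDerivAt (fun W => V i l • φ (preactCLM u l W))
        (V i l • (deriv φ (preact W u l) • preactCLM u l)) W := fun l =>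
      ((h1 l).comp_hasFDerivAt W (preactCLM u l).hasFDerivAt).const_smul (V i l)
    exact (HasFDerivAt.fun_sum fun l _ => h2 l).const_smul (1 / √(k : ℝ))
  have hdiff : DifferentiableAt ℝ (network φ u V) W :=
    differentiableAt_euclidean.2 fun i => (hcoord i).differentiableAt
  have h2 := (EuclideanSpace.proj (𝕜 := ℝ) i).hasFDerivAt.comp W hdiff.hasFDerivAt
  have h3 := congrArg (fun T : Weights k d →L[ℝ] ℝ => T H) (h2.unique (hcoord i))
  simpa [jacobian, preactCLM_apply] using h3

lemma sum_sq_preact_le (H : Weights k d) (u : EuclideanSpace ℝ (Fin d)) :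
    ∑ l, preact H u l ^ 2 ≤ ‖H‖ ^ 2 * ‖u‖ ^ 2 := by
  rw [EuclideanSpace.real_norm_sq_eq, EuclideanSpace.real_norm_sq_eq, Fintype.sum_prod_type,
    Finset.sum_mul]
  exact Finset.sum_le_sum fun l _ => Finset.sum_mul_sq_le_sq_mul_sq _ _ _

lemma norm_le_sqrt_mul {x : EuclideanSpace ℝ (Fin n)} {M : ℝ} (hM : 0 ≤ M) (h : ∀ i, |x i| ≤ M) :
    ‖x‖ ≤ √n * M := by
  refine abs_le_of_sq_le_sq' ?_ (by positivity) |>.2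
  rw [EuclideanSpace.real_norm_sq_eq, mul_pow, Real.sq_sqrt (Nat.cast_nonneg _)]
  have : ∀ i ∈ Finset.univ, x i ^ 2 ≤ M ^ 2 := fun i _ => by
    rw [← sq_abs]
    have := h i
    gcongr
  simpa using Finset.sum_le_card_nsmul _ _ _ this

/-- Each output coordinate is bounded by Cauchy-Schwarz over the hidden units, using ∑ (Hu)_l² ≤
‖H‖²; the n coordinates contribute √n. -/
lemma norm_jacobian_sub_le (hφ : Differentiable ℝ φ) {B : ℝ≥0} (hB : LipschitzWith B (deriv φ))
    {D : ℝ} (hD : 0 ≤ D) (hV : ∀ i l, |V i l| ≤ D) (hu : ‖u‖ = 1) (W W' : Weights k d) :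
    ‖jacobian φ u V W - jacobian φ u V W'‖ ≤ √n * (1 / √(k : ℝ) * (D * B)) * ‖W - W'‖ := by
  refine ContinuousLinearMap.opNorm_le_bound _ (by positivity) fun H => ?_
  rw [mul_assoc, mul_assoc]
  refine norm_le_sqrt_mul (by positivity) fun i => ?_
  rw [_root_.sub_apply, PiLp.sub_apply, jacobian_apply hφ, jacobian_apply hφ, ← mul_sub,
    ← Finset.sum_sub_distrib, abs_mul, abs_of_nonneg (by positivity : 0 ≤ 1 / √(k : ℝ)), mul_assoc]
  gcongr
  have hsub : ∀ l, preact W u l - preact W' u l = preact (W - W') u l := fun l => by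
    simp only [← preactCLM_apply, map_sub]
  have h1 : ∀ l ∈ Finset.univ, |V i l * (deriv φ (preact W u l) * preact H u l) -
      V i l * (deriv φ (preact W' u l) * preact H u l)| ≤
      D * B * (|preact (W - W') u l| * |preact H u l|) := fun l _ => by
    rw [← mul_sub, ← sub_mul, abs_mul, abs_mul]
    have h2 := hB.dist_le_mul (preact W u l) (preact W' u l)
    rw [Real.dist_eq, Real.dist_eq, hsub] at h2
    calc _ ≤ D * (B * |preact (W - W') u l| * |preact H u l|) := by
          gcongr
          exact hV i l
      _ = _ := by ring
  refine (Finset.abs_sum_le_sum_abs _ _).trans ((Finset.sum_le_sum h1).trans ?_)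
  rw [← Finset.mul_sum]
  gcongr
  have h3 := Finset.sum_mul_sq_le_sq_mul_sq Finset.univ (fun l => |preact (W - W') u l|)
    (fun l => |preact H u l|)
  simp only [sq_abs] at h3
  have h4 := sum_sq_preact_le (W - W') u
  have h5 := sum_sq_preact_le H u
  rw [hu, one_pow, mul_one] at h4 h5
  refine abs_le_of_sq_le_sq' ?_ (by positivity) |>.2
  rw [mul_pow]
  exact h3.trans (mul_le_mul h4 h5 (Finset.sum_nonneg fun _ _ => sq_nonneg _) (sq_nonneg _))

lemma le_norm_adjoint_jacobian_sq (hφ : Differentiable ℝ φ) (hk : 1 ≤ k) (hu : ‖u‖ = 1)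
    {W : Weights k d} {s : ℝ} (h : ∀ x : Fin n → ℝ, ‖WithLp.toLp 2 x‖ = 1 →
      s ≤ ∑ l, deriv φ (preact W u l) ^ 2 * (columns V l ⬝ᵥ x) ^ 2)
    (z : EuclideanSpace ℝ (Fin n)) :
    s / k * ‖z‖ ^ 2 ≤ ‖ContinuousLinearMap.adjoint (jacobian φ u V W) z‖ ^ 2 := by
  have hk0 : (0 : ℝ) < k := by exact_mod_cast hk
  set w : Fin k → ℝ := fun l => deriv φ (preact W u l) * (columns V l ⬝ᵥ z.ofLp) with hw
  set S := ∑ l, w l ^ 2 with hS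
  have hS0 : 0 ≤ S := Finset.sum_nonneg fun _ _ => sq_nonneg _
  have hSz : s * ‖z‖ ^ 2 ≤ S := by
    by_cases hz : z = 0
    · simp [hz, hS0]
    have hzn := norm_pos_iff.2 hz
    have h1 := h (‖z‖⁻¹ • z.ofLp) (by
      rw [WithLp.toLp_smul, norm_smul, norm_inv, norm_norm]
      exact inv_mul_cancel₀ hzn.ne')
    simp only [dotProduct_smul, smul_eq_mul, mul_pow, inv_pow] at h1
    have e : ∑ l, deriv φ (preact W u l) ^ 2 * ((‖z‖ ^ 2)⁻¹ * (columns V l ⬝ᵥ z.ofLp) ^ 2) =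
        S / ‖z‖ ^ 2 := by
      rw [hS, Finset.sum_div]
      refine Finset.sum_congr rfl fun l _ => ?_
      rw [hw]
      ring
    rwa [e, le_div_iff₀ (by positivity)] at h1
  -- The extremal test matrix: H is √k times the adjoint applied to z, so Cauchy-Schwarz loses
  -- nothing.
  set H : Weights k d := WithLp.toLp 2 fun e => w e.1 * u e.2 with hH
  have hu2 : ∑ j, u j ^ 2 = 1 := by rw [← EuclideanSpace.real_norm_sq_eq, hu, one_pow]
  have hHn : ‖H‖ ^ 2 = S := by
    rw [EuclideanSpace.real_norm_sq_eq, Fintype.sum_prod_type]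
    simp only [hH, mul_pow, ← Finset.mul_sum, hu2, mul_one, hS]
  have hpH : ∀ l, preact H u l = w l := fun l => by
    have : preact H u l = w l * ∑ j, u j ^ 2 := by
      simp only [preact, hH, Finset.mul_sum]
      exact Finset.sum_congr rfl fun j _ => by ring
    rw [this, hu2, mul_one]
  have hinner : inner ℝ (ContinuousLinearMap.adjoint (jacobian φ u V W) z) H = 1 / √(k : ℝ) * S := by
    rw [ContinuousLinearMap.adjoint_inner_left, PiLp.inner_apply]
    simp only [jacobian_apply hφ, hpH, RCLike.inner_apply, conj_trivial, Finset.mul_sum,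
      Finset.sum_mul, hS]
    rw [Finset.sum_comm]
    refine Finset.sum_congr rfl fun l _ => ?_
    have e : w l ^ 2 = ∑ i, w l * deriv φ (preact W u l) * (V i l * z i) := by
      rw [← Finset.mul_sum]
      simp only [hw, dotProduct, columns]
      ring
    rw [e, Finset.mul_sum]
    exact Finset.sum_congr rfl fun i _ => by ring
  have hcs := real_inner_le_norm (ContinuousLinearMap.adjoint (jacobian φ u V W) z) H
  rw [hinner] at hcs
  have hsq : (1 / √(k : ℝ) * S) ^ 2 ≤
      (‖ContinuousLinearMap.adjoint (jacobian φ u V W) z‖ * ‖H‖) ^ 2 := by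
    gcongr
  rw [mul_pow, mul_pow, hHn, div_pow, one_pow, Real.sq_sqrt hk0.le] at hsq
  have h2 : S / k ≤ ‖ContinuousLinearMap.adjoint (jacobian φ u V W) z‖ ^ 2 := by
    rcases hS0.eq_or_lt with h0 | h0
    · rw [← h0, zero_div]; positivity
    · refine le_of_mul_le_mul_right ?_ h0
      calc S / k * S = 1 / k * S ^ 2 := by ring
        _ ≤ _ := hsq
  refine le_trans ?_ h2
  rw [div_mul_eq_mul_div]
  gcongr

lemma le_radius {φ : ℝ → ℝ} {W₀ : Weights k d} {Λ σ : ℝ} (hΛ : 0 < Λ)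
    (hlip : ∀ W W', ‖jacobian φ u V W - jacobian φ u V W'‖ ≤ Λ * ‖W - W'‖)
    (hσ : σ ≤ sigmaMin (jacobian φ u V W₀)) :
    ENNReal.ofReal (σ / (2 * Λ)) ≤ radius φ u V W₀ := by
  have hL : LipschitzWith (Real.toNNReal Λ) (jacobian φ u V) :=
    LipschitzWith.of_dist_le_mul fun W W' => by
      rw [dist_eq_norm, dist_eq_norm, Real.coe_toNNReal _ hΛ.le]
      exact hlip W W'
  unfold radius
  refine le_iSup₂_of_le (Real.toNNReal (σ / (2 * Λ))) ?_ le_rfl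
  have h1 : lipConst (jacobian φ u V) (Metric.closedBall W₀ (Real.toNNReal (σ / (2 * Λ)))) ≤
      ENNReal.ofReal Λ :=
    iInf₂_le (f := fun (K : ℝ≥0) (_ : LipschitzOnWith K (jacobian φ u V) _) => (K : ℝ≥0∞))
      (Real.toNNReal Λ) hL.lipschitzOnWith
  calc _ ≤ 2 * ENNReal.ofReal (σ / (2 * Λ)) * ENNReal.ofReal Λ := by gcongr; exact le_rfl
    _ = ENNReal.ofReal σ := by
      rw [mul_assoc, ← ENNReal.ofReal_mul' hΛ.le, ← ENNReal.ofReal_ofNat 2,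
        ← ENNReal.ofReal_mul (by norm_num)]
      congr 1
      field_simp
    _ ≤ _ := ENNReal.ofReal_le_ofReal hσ

end Network

/-! ### Bounds on the initial misfit and loss -/

section Loss

variable {n m d : ℕ} {C : ℝ} {F : EuclideanSpace ℝ (Fin n) → EuclideanSpace ℝ (Fin m)}
  {L : EuclideanSpace ℝ (Fin m) → ℝ} {xbar : EuclideanSpace ℝ (Fin n)}
  {ε : EuclideanSpace ℝ (Fin m)}

lemma IsForwardOperator.norm_fderiv_le (hF : IsForwardOperator F) {x : EuclideanSpace ℝ (Fin n)}
    (hx : ‖x‖ ≤ C * √(n * Real.log d)) : ‖fderiv ℝ F x‖ ≤ lipF d C F := by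
  have hc : Continuous fun x => ‖fderiv ℝ F x‖ := (hF.contDiff.continuous_fderiv one_ne_zero).norm
  have hb : BddAbove (Set.range fun x : Metric.closedBall (0 : EuclideanSpace ℝ (Fin n))
      (C * √(n * Real.log d)) => ‖fderiv ℝ F x‖) := by
    have := (isCompact_closedBall (0 : EuclideanSpace ℝ (Fin n))
      (C * √(n * Real.log d))).bddAbove_image hc.continuousOn
    rwa [Set.image_eq_range] at this
  exact le_ciSup hb ⟨x, by simpa using hx⟩

lemma lipF_nonneg : 0 ≤ lipF d C F := Real.iSup_nonneg fun _ => norm_nonneg _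

lemma IsForwardOperator.norm_le (hF : IsForwardOperator F) {x : EuclideanSpace ℝ (Fin n)}
    (hx : ‖x‖ ≤ C * √(n * Real.log d)) : ‖F x‖ ≤ C * lipF d C F * √(n * Real.log d) := by
  have h := (convex_closedBall (0 : EuclideanSpace ℝ (Fin n))
    (C * √(n * Real.log d))).norm_image_sub_le_of_norm_fderiv_le (𝕜 := ℝ) (f := F)
    (C := lipF d C F) (x := 0) (y := x)
    (fun x _ => (hF.contDiff.differentiable one_ne_zero) x)
    (fun x hx => hF.norm_fderiv_le (by simpa using hx))
    (by simpa using (norm_nonneg x).trans hx) (by simpa using hx)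
  rw [hF.map_zero, sub_zero, sub_zero] at h
  calc ‖F x‖ ≤ lipF d C F * ‖x‖ := h
    _ ≤ lipF d C F * (C * √(n * Real.log d)) := mul_le_mul_of_nonneg_left hx lipF_nonneg
    _ = _ := by ring

lemma norm_le_sqrt_mul_supNorm (v : EuclideanSpace ℝ (Fin m)) : ‖v‖ ≤ √m * supNorm v :=
  norm_le_sqrt_mul (Real.iSup_nonneg fun _ => abs_nonneg _)
    fun i => le_ciSup (f := fun i => |v i|) (Set.finite_range _).bddAbove i

lemma norm_obs_le_misfit (hC : 0 ≤ C) : ‖F xbar + ε‖ ≤ misfit d C F xbar ε := by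
  have h1 : 0 ≤ C * lipF d C F * √(n * Real.log d) :=
    mul_nonneg (mul_nonneg hC lipF_nonneg) (Real.sqrt_nonneg _)
  have h2 := norm_le_sqrt_mul_supNorm (F xbar)
  have h3 := norm_le_sqrt_mul_supNorm ε
  have h4 := norm_add_le (F xbar) ε
  rw [misfit, mul_add]
  linarith

lemma le_misfit : C * lipF d C F * √(n * Real.log d) ≤ misfit d C F xbar ε := by
  rw [misfit]
  have h1 : 0 ≤ supNorm (F xbar) := Real.iSup_nonneg fun _ => abs_nonneg _
  have h2 : 0 ≤ supNorm ε := Real.iSup_nonneg fun _ => abs_nonneg _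
  have : 0 ≤ √(m : ℝ) * (supNorm (F xbar) + supNorm ε) := by positivity
  linarith

lemma norm_sub_obs_le_misfit {v : EuclideanSpace ℝ (Fin m)}
    (hv : ‖v‖ ≤ C * lipF d C F * √(n * Real.log d)) :
    ‖v - (F xbar + ε)‖ ≤ misfit d C F xbar ε := by
  have h2 := norm_le_sqrt_mul_supNorm (F xbar)
  have h3 := norm_le_sqrt_mul_supNorm ε
  have h4 := norm_add_le (F xbar) ε
  have h5 := norm_sub_le v (F xbar + ε)
  rw [misfit, mul_add]
  linarith

lemma IsLoss.gradient_obs {y : EuclideanSpace ℝ (Fin m)} (hL : IsLoss L y) : ∇ L y = 0 := by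
  have h : IsLocalMin L y := Filter.Eventually.of_forall fun v => by
    rw [hL.obs_min]
    exact hL.min_zero.2 ⟨v, rfl⟩
  rw [gradient, h.fderiv_eq_zero, map_zero]

lemma lipL_nonneg : 0 ≤ lipL d C F L xbar ε :=
  Real.iSup_nonneg fun _ => div_nonneg (norm_nonneg _) (norm_nonneg _)

lemma IsLoss.norm_gradient_le (hL : IsLoss L (F xbar + ε)) (hC : 0 ≤ C)
    {v : EuclideanSpace ℝ (Fin m)} (hv : ‖v‖ ≤ misfit d C F xbar ε) :
    ‖∇ L v‖ ≤ lipL d C F L xbar ε * ‖v - (F xbar + ε)‖ := by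
  obtain ⟨K, hK⟩ := hL.lipschitz_gradient _
    (Metric.isBounded_closedBall (x := (0 : EuclideanSpace ℝ (Fin m))) (r := misfit d C F xbar ε))
  have hy := norm_obs_le_misfit (d := d) (F := F) (xbar := xbar) (ε := ε) hC
  have h1 : ∀ w, ‖w‖ ≤ misfit d C F xbar ε → ‖∇ L w‖ ≤ K * ‖w - (F xbar + ε)‖ := fun w hw => by
    have := hK.dist_le_mul w (by simpa using hw) (F xbar + ε) (by simpa using hy)
    rwa [hL.gradient_obs, dist_zero_right, dist_eq_norm] at this
  -- At v = y the quotient in the supremum is 0/0 = 0 and gives no information; there the gradient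
  -- vanishes.
  by_cases h0 : ‖v - (F xbar + ε)‖ = 0
  · have := h1 v hv
    rw [h0, mul_zero] at this ⊢
    exact this
  have hb : BddAbove (Set.range fun v : Metric.closedBall (0 : EuclideanSpace ℝ (Fin m))
      (misfit d C F xbar ε) => ‖∇ L v‖ / ‖(v : EuclideanSpace ℝ (Fin m)) - (F xbar + ε)‖) := by
    refine ⟨K, ?_⟩
    rintro r ⟨w, rfl⟩
    exact div_le_of_le_mul₀ (norm_nonneg _) K.2 (h1 w (mem_closedBall_zero_iff.1 w.2))
  have h2 := le_ciSup hb ⟨v, by simpa using hv⟩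
  rwa [div_le_iff₀ (lt_of_le_of_ne (norm_nonneg _) (Ne.symm h0))] at h2

lemma IsLoss.le_lossBound (hL : IsLoss L (F xbar + ε)) (hC : 0 ≤ C)
    {v : EuclideanSpace ℝ (Fin m)} (hv : ‖v‖ ≤ misfit d C F xbar ε)
    (hvy : ‖v - (F xbar + ε)‖ ≤ misfit d C F xbar ε) : L v ≤ lossBound d C F L xbar ε := by
  set y := F xbar + ε with hy
  set K := lipL d C F L xbar ε
  have hK : 0 ≤ K := lipL_nonneg
  have hym : ‖y‖ ≤ misfit d C F xbar ε := norm_obs_le_misfit hC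
  -- Descent lemma along the segment from y to v: f is nondecreasing since ‖∇L(w)‖ ≤ K‖w - y‖ on it.
  set f : ℝ → ℝ := fun t => K / 2 * ‖v - y‖ ^ 2 * t ^ 2 - L (y + t • (v - y)) with hf
  have hd : ∀ t, HasDerivAt f (K * ‖v - y‖ ^ 2 * t - inner ℝ (∇ L (y + t • (v - y))) (v - y)) t := by
    intro t
    have h1 : HasDerivAt (fun t : ℝ => y + t • (v - y)) (v - y) t := by
      simpa using ((hasDerivAt_id t).smul_const (v - y)).const_add y
    have h2 := ((hL.contDiff.differentiable one_ne_zero)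
      (y + t • (v - y))).hasGradientAt.hasFDerivAt.comp_hasDerivAt t h1
    have h3 := ((hasDerivAt_id t).pow 2).const_mul (K / 2 * ‖v - y‖ ^ 2)
    have h4 := h3.sub h2
    refine h4.congr_deriv ?_
    simp only [InnerProductSpace.toDual_apply_apply, id]
    ring
  have hmono : MonotoneOn f (Set.Icc 0 1) := by
    refine monotoneOn_of_hasDerivWithinAt_nonneg (convex_Icc 0 1)
      (fun t _ => (hd t).continuousAt.continuousWithinAt) (fun t _ => (hd t).hasDerivWithinAt) ?_
    intro t ht
    rw [interior_Icc] at ht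
    have hmem : ‖y + t • (v - y)‖ ≤ misfit d C F xbar ε := by
      have hc := convex_closedBall (0 : EuclideanSpace ℝ (Fin m)) (misfit d C F xbar ε)
      have := hc.add_smul_sub_mem (x := y) (y := v) (by simpa using hym) (by simpa using hv)
        ⟨ht.1.le, ht.2.le⟩
      simpa using this
    have h1 := hL.norm_gradient_le hC hmem
    rw [← hy, add_sub_cancel_left, norm_smul, Real.norm_of_nonneg ht.1.le] at h1
    have h2 := real_inner_le_norm (∇ L (y + t • (v - y))) (v - y)
    have h3 := mul_le_mul_of_nonneg_right h1 (norm_nonneg (v - y))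
    nlinarith
  have h := hmono (Set.left_mem_Icc.2 zero_le_one) (Set.right_mem_Icc.2 zero_le_one) zero_le_one
  have hf0 : f 0 = 0 := by simp [hf, hL.obs_min]
  have hf1 : f 1 = K / 2 * ‖v - y‖ ^ 2 - L v := by simp [hf]
  rw [hf0, hf1] at h
  rw [lossBound]
  have : K / 2 * ‖v - y‖ ^ 2 ≤ K / 2 * misfit d C F xbar ε ^ 2 := by gcongr
  linarith

/-- If `y` is the only minimizer, then the desingularizing function controls the misfit bound. -/
lemma misfit_le_of_unique (hm : 1 ≤ m) (hL : IsLoss L (F xbar + ε)) (hC : 0 ≤ C) {ψ : ℝ → ℝ}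
    {r₀ : ℝ} (hψ : KLInequality L ψ r₀) (hr : lossBound d C F L xbar ε < r₀)
    (huniq : ∀ v, L v = 0 → v = F xbar + ε) :
    misfit d C F xbar ε ≤ ψ (lossBound d C F L xbar ε) := by
  set y := F xbar + ε with hy
  set ρ := misfit d C F xbar ε
  have hym : ‖y‖ ≤ ρ := norm_obs_le_misfit hC
  have hρ : 0 ≤ ρ := (norm_nonneg _).trans hym
  have : Nonempty (Fin m) := ⟨⟨0, hm⟩⟩
  obtain ⟨e, he, hye⟩ : ∃ e : EuclideanSpace ℝ (Fin m), ‖e‖ = 1 ∧ y = ‖y‖ • e := by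
    by_cases h0 : y = 0
    · obtain ⟨e, he⟩ := exists_norm_eq (EuclideanSpace ℝ (Fin m)) zero_le_one
      exact ⟨e, he, by simp [h0]⟩
    · refine ⟨‖y‖⁻¹ • y, norm_smul_inv_norm h0, ?_⟩
      rw [smul_smul, mul_inv_cancel₀ (norm_ne_zero_iff.2 h0), one_smul]
  -- Going from y through the origin, v has distance exactly ρ from y and stays in the ball of
  -- radius ρ because ‖y‖ ≤ ρ.
  set v := y - ρ • e with hv
  have hvy : ‖v - y‖ = ρ := by
    rw [hv, sub_sub_cancel_left, norm_neg, norm_smul, he, mul_one, Real.norm_of_nonneg hρ]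
  have hvn : ‖v‖ ≤ ρ := by
    have : v = (‖y‖ - ρ) • e := by rw [hv, sub_smul, ← hye]
    rw [this, norm_smul, he, mul_one, Real.norm_eq_abs, abs_le]
    constructor <;> linarith [norm_nonneg y]
  have hLv := hL.le_lossBound hC hvn hvy.le
  have h0 : 0 ≤ L v := hL.min_zero.2 ⟨v, rfl⟩
  have h1 := hψ.norm_sub_le hL huniq (hLv.trans_lt hr)
  rw [hvy] at h1
  exact h1.trans (hψ.strictMonoOn.monotoneOn ⟨h0, hLv.trans_lt hr⟩ ⟨h0.trans hLv, hr⟩ hLv)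

end Loss

/-! ### Constants of the activation and good events -/

section Main

open Matrix

lemma IsActivation.integral_deriv_sq_pos {φ : ℝ → ℝ} (hφ : IsActivation φ) :
    0 < ∫ x, deriv φ x ^ 2 ∂(gaussianReal 0 1) := by
  obtain ⟨B, hB0, hB, hLip⟩ := hφ.deriv_bound
  have hc : Continuous fun x => deriv φ x ^ 2 := hLip.continuous.pow 2
  have hi : Integrable (fun x => deriv φ x ^ 2) (gaussianReal 0 1) := by
    refine Integrable.of_bound (C := (B : ℝ) ^ 2) hc.aestronglyMeasurable (ae_of_all _ fun x => ?_)
    rw [norm_pow, Real.norm_eq_abs]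
    have := hB x
    gcongr
  rw [integral_pos_iff_support_of_nonneg (fun x => sq_nonneg _) hi]
  obtain ⟨x, hx⟩ : ∃ x, deriv φ x ≠ 0 := by
    by_contra! h
    obtain ⟨x, x', hxx⟩ := hφ.nonconstant
    exact hxx (is_const_of_deriv_eq_zero (hφ.contDiff.differentiable one_ne_zero) h x x')
  have hpos : 0 < volume (Function.support fun x => deriv φ x ^ 2) :=
    hc.isOpen_support.measure_pos _ ⟨x, by simpa using hx⟩
  refine pos_iff_ne_zero.2 fun h0 => hpos.ne' ?_
  exact gaussianReal_absolutelyContinuous' 0 one_ne_zero h0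

/-- φ grows at most linearly with slope B, so φ(x)²/(8B²) ≤ φ(0)²/(4B²) + x²/4, and exp(x²/4) is
Gaussian integrable. -/
lemma integrable_exp_sq_activation {φ : ℝ → ℝ} (hφ : ContDiff ℝ 1 φ) {B : ℝ} (hB0 : 0 < B)
    (hB : ∀ x, |deriv φ x| ≤ B) :
    Integrable (fun x => Real.exp (1 / (8 * B ^ 2) * φ x ^ 2)) (gaussianReal 0 1) := by
  have hc := hφ.continuous
  refine Integrable.mono' (integrable_exp_sq_div_four_gaussianReal.const_mul
    (Real.exp (φ 0 ^ 2 / (4 * B ^ 2)))) (by fun_prop) (ae_of_all _ fun x => ?_)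
  rw [Real.norm_of_nonneg (Real.exp_pos _).le, ← Real.exp_add, Real.exp_le_exp]
  have h1 : |φ x - φ 0| ≤ B * |x| := by
    have := convex_univ.norm_image_sub_le_of_norm_deriv_le (f := φ) (C := B) (x := 0) (y := x)
      (fun x _ => (hφ.differentiable one_ne_zero) x) (fun x _ => hB x) trivial trivial
    simpa using this
  have h2 : (φ x - φ 0) ^ 2 ≤ B ^ 2 * x ^ 2 := by
    rw [← sq_abs, ← sq_abs x, ← mul_pow]
    gcongr
  have h3 : φ x ^ 2 ≤ 2 * φ 0 ^ 2 + 2 * (B ^ 2 * x ^ 2) := by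
    nlinarith [sq_nonneg (φ x - 2 * φ 0)]
  calc 1 / (8 * B ^ 2) * φ x ^ 2 ≤ 1 / (8 * B ^ 2) * (2 * φ 0 ^ 2 + 2 * (B ^ 2 * x ^ 2)) := by gcongr
    _ = _ := by field_simp; ring

lemma exists_measurableSet_of_measure_le {Ω : Type*} [MeasurableSpace Ω] {μ : Measure Ω}
    [IsProbabilityMeasure μ] {bad : Set Ω} {a b : ℝ} (ha : 0 ≤ a) (hb : 0 ≤ b)
    (h : μ bad ≤ ENNReal.ofReal a + ENNReal.ofReal b) :
    ∃ E : Set Ω, MeasurableSet E ∧ 1 - a - b ≤ μ.real E ∧ ∀ ω ∈ E, ω ∉ bad := by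
  refine ⟨(toMeasurable μ bad)ᶜ, (measurableSet_toMeasurable μ bad).compl, ?_,
    fun ω hω hb => hω (subset_toMeasurable μ bad hb)⟩
  rw [probReal_compl_eq_one_sub (measurableSet_toMeasurable μ bad), measureReal_def,
    measure_toMeasurable]
  rw [← ENNReal.ofReal_add ha hb] at h
  have := ENNReal.toReal_le_of_le_ofReal (add_nonneg ha hb) h
  linarith

variable {n m d k : ℕ} {φ : ℝ → ℝ} {D : ℝ}

lemma IsInitialization.mono {Ω : Type*} [MeasurableSpace Ω] {μ : Measure Ω}
    {u : Ω → EuclideanSpace ℝ (Fin d)} {W : Ω → Weights k d} {V : Ω → Matrix (Fin n) (Fin k) ℝ}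
    {D' : ℝ} (h : IsInitialization μ D u W V) (hD : D ≤ D') : IsInitialization μ D' u W V :=
  { h with bounded_V := fun i l => (h.bounded_V i l).mono fun _ hω => hω.trans hD }

lemma sigmaF_le_norm {F : EuclideanSpace ℝ (Fin n) → EuclideanSpace ℝ (Fin m)}
    {u : EuclideanSpace ℝ (Fin d)} {V : Matrix (Fin n) (Fin k) ℝ} {Θ : Set (Weights k d)}
    {W : Weights k d} (hW : W ∈ Θ) : sigmaF F φ u V Θ ≤ ‖fderiv ℝ F (network φ u V W)‖ := by
  refine le_trans ?_ (sigmaMin_le_norm _)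
  refine ciInf_le (f := fun x : network φ u V '' Θ => sigmaMin (fderiv ℝ F x)) ⟨0, ?_⟩
    ⟨network φ u V W, W, hW, rfl⟩
  rintro r ⟨x, rfl⟩
  exact sigmaMin_nonneg _

/-! ### Deterministic consequences on the good events -/

section Deterministic

variable {F : EuclideanSpace ℝ (Fin n) → EuclideanSpace ℝ (Fin m)}
  {L : EuclideanSpace ℝ (Fin m) → ℝ} {xbar : EuclideanSpace ℝ (Fin n)}
  {ε : EuclideanSpace ℝ (Fin m)} {ψ : ℝ → ℝ} {r₀ C C' : ℝ}
  {u : EuclideanSpace ℝ (Fin d)} {V : Matrix (Fin n) (Fin k) ℝ} {W : Weights k d}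
  {Θ : Set (Weights k d)}

/-- If `y` is the only minimizer, then the lower bound on the width implies `k ≥ C' C² n² log d`. -/
lemma width_lower_bound_of_unique (hn : 1 ≤ n) (hm : 1 ≤ m) (hF : IsForwardOperator F)
    (hL : IsLoss L (F xbar + ε)) (hC : 0 ≤ C) (hC' : 0 ≤ C') (hψ : KLInequality L ψ r₀)
    (hr : lossBound d C F L xbar ε < r₀) (huniq : ∀ v, L v = 0 → v = F xbar + ε)
    (hnorm : ‖network φ u V W‖ ≤ C * √(n * Real.log d)) (hW : W ∈ Θ)
    (hσ : 0 < sigmaF F φ u V Θ)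
    (hk : C' * (sigmaF F φ u V Θ ^ 2)⁻¹ * n * ψ (lossBound d C F L xbar ε) ^ 2 ≤ k) :
    C' * C ^ 2 * n ^ 2 * Real.log d ≤ k := by
  set σ := sigmaF F φ u V Θ
  have h1 : σ ≤ lipF d C F := (sigmaF_le_norm hW).trans (hF.norm_fderiv_le hnorm)
  have h2 := misfit_le_of_unique hm hL hC hψ hr huniq
  have h3 : C * σ * √(n * Real.log d) ≤ ψ (lossBound d C F L xbar ε) := by
    refine le_trans ?_ (le_misfit.trans h2)
    gcongr
  have hlog : 0 ≤ Real.log d := Real.log_natCast_nonneg d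
  have h4 : (C * σ * √(n * Real.log d)) ^ 2 ≤ ψ (lossBound d C F L xbar ε) ^ 2 := by gcongr
  rw [mul_pow, mul_pow, Real.sq_sqrt (by positivity)] at h4
  calc C' * C ^ 2 * n ^ 2 * Real.log d
      = C' * (σ ^ 2)⁻¹ * n * (C ^ 2 * σ ^ 2 * (n * Real.log d)) := by field_simp
    _ ≤ _ := by gcongr
    _ ≤ k := hk

lemma initCondition_of_good (hn : 1 ≤ n) (hk : 1 ≤ k) (hφ : Differentiable ℝ φ) {B : ℝ≥0}
    (hB0 : 0 < B) (hB : LipschitzWith B (deriv φ)) (hD : 0 < D) (hF : IsForwardOperator F)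
    (hL : IsLoss L (F xbar + ε)) (hC : 0 ≤ C) (hψ : KLInequality L ψ r₀)
    (hr : lossBound d C F L xbar ε < r₀) {γ : ℝ} (hγ : 0 < γ)
    (hC' : (16 * B * D / γ) ^ 2 < C')
    (hV : ∀ i l, |V i l| ≤ D) (hu : ‖u‖ = 1)
    (hnorm : ‖network φ u V W‖ ≤ C * √(n * Real.log d))
    (hmat : ∀ x : Fin n → ℝ, ‖WithLp.toLp 2 x‖ = 1 →
      γ * k / 4 ≤ ∑ l, deriv φ (preact W u l) ^ 2 * (columns V l ⬝ᵥ x) ^ 2)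
    (hσ : 0 < sigmaF F φ u V Θ)
    (hkk : C' * (sigmaF F φ u V Θ ^ 2)⁻¹ * n * ψ (lossBound d C F L xbar ε) ^ 2 ≤ k) :
    InitCondition F L ψ r₀ φ u V Θ W := by
  have hk0 : (0 : ℝ) < k := by exact_mod_cast hk
  have hn0 : (0 : ℝ) < n := by exact_mod_cast hn
  have hB0' : (0 : ℝ) < B := hB0
  have hC'0 : 0 < C' := (sq_nonneg _).trans_lt hC'
  have hFn := hF.norm_le hnorm
  have hloss := hL.le_lossBound hC (hFn.trans le_misfit) (norm_sub_obs_le_misfit hFn)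
  have hL0 : 0 ≤ L (F (network φ u V W)) := hL.min_zero.2 ⟨_, rfl⟩
  have hadj : ∀ z, √γ / 2 * ‖z‖ ≤ ‖ContinuousLinearMap.adjoint (jacobian φ u V W) z‖ := fun z => by
    have h1 := le_norm_adjoint_jacobian_sq hφ hk hu hmat z
    refine abs_le_of_sq_le_sq' ?_ (norm_nonneg _) |>.2
    rw [mul_pow, div_pow, Real.sq_sqrt hγ.le]
    refine le_trans (le_of_eq ?_) h1
    field_simp
    ring
  have hs0 : 0 < √γ / 2 := by positivity
  have : Nonempty (Fin n) := ⟨⟨0, hn⟩⟩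
  have hsmin := le_sigmaMin hs0 hadj
  refine ⟨hloss.trans_lt hr, surjective_of_le_norm_adjoint hs0 hadj, hs0.trans_le hsmin, ?_⟩
  set σ := sigmaMin (jacobian φ u V W)
  set τ := sigmaF F φ u V Θ with hτ
  set P := ψ (lossBound d C F L xbar ε)
  have hσ0 : 0 < σ := hs0.trans_le hsmin
  have hσ2 : γ / 4 ≤ σ ^ 2 := by
    have : (√γ / 2) ^ 2 ≤ σ ^ 2 := by gcongr
    rwa [div_pow, Real.sq_sqrt hγ.le, show (2 : ℝ) ^ 2 = 4 by norm_num] at this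
  set Λ := √n * (1 / √(k : ℝ) * (D * B)) with hΛ
  have hΛ0 : 0 < Λ := by positivity
  refine lt_of_lt_of_le ?_ (le_radius hΛ0 (norm_jacobian_sub_le hφ hB hD.le hV hu) le_rfl)
  rw [ENNReal.ofReal_lt_ofReal_iff (by positivity)]
  have hP0 : 0 ≤ P := by
    rw [← hψ.map_zero]
    exact hψ.strictMonoOn.monotoneOn ⟨le_rfl, hψ.pos⟩ ⟨hL0.trans hloss, hr⟩ (hL0.trans hloss)
  have hψP : ψ (L (F (network φ u V W))) ≤ P :=
    hψ.strictMonoOn.monotoneOn ⟨hL0, hloss.trans_lt hr⟩ ⟨hL0.trans hloss, hr⟩ hloss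
  -- With σ² ≥ γ/4 this is stronger than the required 4ΛP < τσ². After squaring, the factors of n
  -- and k cancel against the width bound and leave (16BD/γ)² < C'.
  have hΛP : 16 * Λ * P < τ * γ := by
    have h1 : (16 * Λ * P) ^ 2 = (16 * B * D) ^ 2 * (n * P ^ 2) / k := by
      rw [hΛ, mul_pow, mul_pow, mul_pow, mul_pow, div_pow, Real.sq_sqrt hn0.le, Real.sq_sqrt hk0.le]
      ring
    have h2 : n * P ^ 2 ≤ k * τ ^ 2 / C' := by
      rw [le_div_iff₀ hC'0]
      calc n * P ^ 2 * C' = (C' * (τ ^ 2)⁻¹ * n * P ^ 2) * τ ^ 2 := by field_simp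
        _ ≤ _ := by gcongr
    have h3 : (16 * B * D) ^ 2 < C' * γ ^ 2 := by
      rwa [div_pow, div_lt_iff₀ (by positivity)] at hC'
    refine abs_lt_of_sq_lt_sq' ?_ (by positivity) |>.2
    rw [h1]
    calc (16 * B * D) ^ 2 * (n * P ^ 2) / k ≤ (16 * B * D) ^ 2 * (k * τ ^ 2 / C') / k := by gcongr
      _ = (16 * B * D) ^ 2 * (τ ^ 2 / C') := by field_simp
      _ < C' * γ ^ 2 * (τ ^ 2 / C') := by gcongr
      _ = _ := by field_simp
  calc radius' F L ψ φ u V Θ W ≤ 2 / (τ * σ) * P := by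
        rw [radius']
        gcongr
    _ < σ / (2 * Λ) := by
        rw [div_mul_eq_mul_div, div_lt_div_iff₀ (by positivity) (by positivity)]
        have : τ * (γ / 4) ≤ τ * σ ^ 2 := by gcongr
        nlinarith

end Deterministic

end Main

end DIP

/-! ### Choice of constants and assembly -/

open DIP in
theorem mainTheorem3 (φ : ℝ → ℝ) (hφ : DIP.IsActivation φ) (D : ℝ) :
    ∃ C C' : ℝ, 0 < C ∧ 0 < C' ∧
      ∀ (n m d k : ℕ), 1 ≤ n → 1 ≤ m → 1 ≤ d → 1 ≤ k →
      ∀ (Ω : Type*) [MeasurableSpace Ω] (μ : Measure Ω) [IsProbabilityMeasure μ]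
        (u : Ω → EuclideanSpace ℝ (Fin d)) (W : Ω → DIP.Weights k d)
        (V : Ω → Matrix (Fin n) (Fin k) ℝ), DIP.IsInitialization μ D u W V →
      ∀ (F : EuclideanSpace ℝ (Fin n) → EuclideanSpace ℝ (Fin m)), DIP.IsForwardOperator F →
      ∀ (xbar : EuclideanSpace ℝ (Fin n)) (ε : EuclideanSpace ℝ (Fin m))
        (L : EuclideanSpace ℝ (Fin m) → ℝ), DIP.IsLoss L (F xbar + ε) →
      ∀ (ψ : ℝ → ℝ) (r₀ : ℝ), DIP.KLInequality L ψ r₀ →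
        DIP.lossBound d C F L xbar ε < r₀ →
        ((∀ v, L v = 0 → v = F xbar + ε) ∨ C' * n * Real.log n ≤ k) →
        ∃ E : Set Ω, MeasurableSet E ∧ 1 - 1 / (n : ℝ) - 1 / (d : ℝ) ≤ μ.real E ∧
          ∀ ω ∈ E, ∀ Θ : Set (DIP.Weights k d), W ω ∈ Θ →
            0 < DIP.sigmaF F φ (u ω) (V ω) Θ →
            C' * (DIP.sigmaF F φ (u ω) (V ω) Θ ^ 2)⁻¹ * n *
              ψ (DIP.lossBound d C F L xbar ε) ^ 2 ≤ k →
            DIP.InitCondition F L ψ r₀ φ (u ω) (V ω) Θ (W ω) := by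
  obtain ⟨B, hB0, hB, hLip⟩ := hφ.deriv_bound
  have hB0' : (0 : ℝ) < B := hB0
  have hdiff := hφ.contDiff.differentiable one_ne_zero
  set γ := ∫ x, deriv φ x ^ 2 ∂(gaussianReal 0 1) with hγ
  have hγ0 : 0 < γ := hφ.integral_deriv_sq_pos
  -- Enlarging D to at least 1 makes it positive and gives φ'² ≤ B² ≤ 4K in the Chernoff bound.
  set D₁ := max D 1
  have hD1 : 1 ≤ D₁ := le_max_right _ _
  have hD0 : 0 < D₁ := one_pos.trans_le hD1
  set a : ℝ := 1 / (8 * (B : ℝ) ^ 2) with ha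
  have ha0 : 0 < a := by positivity
  have hint := integrable_exp_sq_activation hφ.contDiff hB0' hB
  set M := ∫ x, Real.exp (a * φ x ^ 2) ∂(gaussianReal 0 1) with hM
  have hM1 : 1 ≤ M := by
    have h := integral_mono (integrable_const (μ := gaussianReal 0 1) (1 : ℝ)) hint
      (fun x => Real.one_le_exp (by positivity))
    simp only [integral_const, probReal_univ, one_smul] at h
    exact h
  set κ := subgaussConst D₁ a M with hκ
  have hκ0 : 0 < κ := by
    have h1 : 0 < D₁ ^ 2 / (4 * a) := by positivity
    have h2 : 0 ≤ D₁ ^ 2 * (M - 1) / (2 * a) := by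
      have := sub_nonneg.2 hM1
      positivity
    rw [hκ, subgaussConst]
    linarith
  set M₂ := ∫ x : ℝ, Real.exp (x ^ 2 / 4) ∂(gaussianReal 0 1)
  have hM₂ : 1 ≤ M₂ := one_le_integral_exp_sq
  have hlogM : 0 ≤ Real.log M₂ := Real.log_nonneg hM₂
  have hlog2 : 0 < Real.log 2 := Real.log_pos one_lt_two
  -- This C makes exp((C²/(8κ) - 1) log 2) equal to M₂, as the tail bound needs.
  obtain ⟨C, hC0, hC2⟩ : ∃ C : ℝ, 0 < C ∧ C ^ 2 = 8 * κ * (1 + Real.log M₂ / Real.log 2) :=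
    ⟨√(8 * κ * (1 + Real.log M₂ / Real.log 2)), Real.sqrt_pos.2 (by positivity),
      Real.sq_sqrt (by positivity)⟩
  obtain ⟨C₁, hC₁⟩ : ∃ C₁ : ℝ, C₁ = 16 * (B : ℝ) ^ 2 * D₁ ^ 2 / γ := ⟨_, rfl⟩
  have hC₁0 : 0 < C₁ := by rw [hC₁]; positivity
  -- The three bounds serve, in order, the case k ≥ C' n log n, the case of a unique minimizer, and
  -- the inequality R' < R.
  obtain ⟨C', hC'1, hC'2, hC'3⟩ : ∃ C' : ℝ, C₁ ≤ C' ∧ C₁ / (C ^ 2 * Real.log 2) ≤ C' ∧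
      (16 * B * D₁ / γ) ^ 2 < C' := by
    have h1 : 0 ≤ (16 * B * D₁ / γ) ^ 2 := by positivity
    have h2 : 0 ≤ C₁ / (C ^ 2 * Real.log 2) := by positivity
    exact ⟨C₁ + C₁ / (C ^ 2 * Real.log 2) + (16 * B * D₁ / γ) ^ 2 + 1, by linarith, by linarith,
      by linarith⟩
  have hC'0 : 0 < C' := hC₁0.trans_le hC'1
  refine ⟨C, C', hC0, hC'0, ?_⟩
  intro n m d k hn hm hd hk Ω _ μ _ u W V hinit F hF xbar ε L hL ψ r₀ hψ hr halt
  -- Here the claimed probability is at most 0 and the empty event suffices; otherwise log d ≥ log 2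
  -- is available.
  by_cases hnd : n = 1 ∨ d = 1
  · refine ⟨∅, MeasurableSet.empty, ?_, fun ω hω => hω.elim⟩
    have h1 : (0 : ℝ) ≤ 1 / n := by positivity
    have h2 : (0 : ℝ) ≤ 1 / d := by positivity
    rw [measureReal_empty]
    rcases hnd with h | h
    · rw [h, Nat.cast_one, div_one]; linarith
    · rw [h, Nat.cast_one, div_one]; linarith
  push Not at hnd
  have hn2 : 2 ≤ n := by omega
  have hd2 : 2 ≤ d := by omega
  have hn0 : (0 : ℝ) < n := by exact_mod_cast hn
  have hk0 : (0 : ℝ) < k := by exact_mod_cast hk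
  have hlogn : 0 ≤ Real.log n := Real.log_natCast_nonneg n
  have hinit' := hinit.mono (le_max_left D 1)
  have hcol := hinit'.isColumnLaw
  have hprob := fun l => (hcol l).prob
  have hlaw := hinit'.map_columns_preact
  set ν := fun l => μ.map fun ω => columns (V ω) l
  set Q := (Measure.pi ν).prod (Measure.pi fun _ : Fin k => gaussianReal 0 1) with hQ
  set g : Ω → (Fin k → Fin n → ℝ) × (Fin k → ℝ) := fun ω => (columns (V ω), preact (W ω) (u ω))
  have hg : Measurable g := by
    have hV := hinit.measurable_V
    exact (measurable_pi_iff.2 fun l => measurable_pi_iff.2 fun i => hV i l).prodMk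
      (continuous_preact.measurable.comp (hinit.measurable_W.prodMk hinit.measurable_u))
  have hpre : ∀ S, μ (g ⁻¹' S) ≤ Q S := fun S => by
    rw [← hlaw]
    exact Measure.le_map_apply hg.aemeasurable S
  set badN : Set ((Fin k → Fin n → ℝ) × (Fin k → ℝ)) :=
    {z | C ^ 2 * (n * Real.log d) < ∑ i, output φ i z ^ 2} with hbadN
  have hQN : Q badN ≤ ENNReal.ofReal (1 / d) := by
    refine measure_lt_sum_sq_le hn (fun i => measurable_output hφ.contDiff.continuous i) hκ0
      (fun i s => lintegral_exp_output_le hk hcol hD0.le hφ.contDiff.continuous ha0 hint i s) hd2 ?_ ?_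
    · rw [hC2]
      have : 0 ≤ Real.log M₂ / Real.log 2 := by positivity
      nlinarith
    · have e : (C ^ 2 / (8 * κ) - 1) * Real.log 2 = Real.log M₂ := by
        rw [hC2]
        field_simp
        ring
      rw [e, Real.exp_log (by linarith)]
  have hnormN : ∀ ω, g ω ∉ badN → ‖network φ (u ω) (V ω) (W ω)‖ ≤ C * √(n * Real.log d) := by
    intro ω hω
    rw [hbadN, Set.mem_ofPred_eq, not_lt] at hω
    have hlogd : 0 ≤ Real.log d := Real.log_natCast_nonneg d
    refine abs_le_of_sq_le_sq' ?_ (by positivity) |>.2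
    rw [EuclideanSpace.real_norm_sq_eq, mul_pow, Real.sq_sqrt (by positivity)]
    exact hω
  by_cases hwidth : C₁ * n * Real.log n ≤ k
  · set badM : Set ((Fin k → Fin n → ℝ) × (Fin k → ℝ)) :=
      {z | ∃ x : Fin n → ℝ, ‖WithLp.toLp 2 x‖ = 1 ∧
        ∑ l, deriv φ (z.2 l) ^ 2 * (z.1 l ⬝ᵥ x) ^ 2 ≤ γ * k / 4} with hbadM
    set K := (B : ℝ) ^ 2 * (D₁ ^ 2 * n) with hK
    have hK0 : 0 < K := by positivity
    have hsq : ∀ x, deriv φ x ^ 2 ≤ (B : ℝ) ^ 2 := fun x => by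
      rw [← sq_abs]
      have := hB x
      gcongr
    -- Half of the mean γk/(4K) in the exponent pays for the level s = γk/4; the other half, γk/(8K)
    -- ≥ 2 log n, turns the factor n into 1/n.
    have hQM : Q badM ≤ ENNReal.ofReal (1 / n) := by
      have h1 := measure_exists_quadratic_le (k := k) hK0 (f := fun x => deriv φ x ^ 2)
        (hLip.continuous.pow 2) (fun x => sq_nonneg _)
        (fun x => mul_le_mul_of_nonneg_right (hsq x) (by positivity))
        (fun x => by
          refine (hsq x).trans ?_
          have h2 : (1 : ℝ) ≤ D₁ ^ 2 * n := by
            have : (1 : ℝ) ≤ n := by exact_mod_cast hn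
            nlinarith
          have : 0 < (B : ℝ) ^ 2 := by positivity
          nlinarith)
        (gaussianReal 0 1) ν hcol (γ * k / 4)
      rw [← hγ] at h1
      have h2 : n * Real.exp (-(k * γ / (4 * K))) ≤
          1 / n * Real.exp (-(γ * k / 4 / (2 * K))) := by
        have h3 : 2 * Real.log n ≤ k * γ / (8 * K) := by
          rw [le_div_iff₀ (by positivity)]
          have h4 := mul_le_mul_of_nonneg_right hwidth hγ0.le
          refine le_trans (le_of_eq ?_) h4
          rw [hC₁, hK]
          field_simp
          ring
        have h5 : Real.exp (-(k * γ / (4 * K))) ≤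
            Real.exp (-(2 * Real.log n)) * Real.exp (-(γ * k / 4 / (2 * K))) := by
          rw [← Real.exp_add, Real.exp_le_exp]
          have e1 : γ * k / 4 / (2 * K) = k * γ / (8 * K) := by field_simp; norm_num
          have e2 : k * γ / (4 * K) = 2 * (k * γ / (8 * K)) := by field_simp; norm_num
          rw [e1, e2]
          linarith
        have h6 : n * Real.exp (-(2 * Real.log n)) = 1 / n := by
          rw [Real.exp_neg, two_mul, Real.exp_add, Real.exp_log hn0]
          field_simp
        calc n * Real.exp (-(k * γ / (4 * K)))
            ≤ n * (Real.exp (-(2 * Real.log n)) * Real.exp (-(γ * k / 4 / (2 * K)))) := by gcongr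
          _ = _ := by rw [← mul_assoc, h6]
      have h3 := h1.trans (ENNReal.ofReal_le_ofReal h2)
      rw [ENNReal.ofReal_mul (by positivity)] at h3
      exact (ENNReal.mul_le_mul_iff_left (by simp [Real.exp_pos]) ENNReal.ofReal_ne_top).1 h3
    set null : Set Ω := {ω | ¬ (‖u ω‖ = 1 ∧ ∀ i l, |V ω i l| ≤ D₁)} with hnull
    have hnull0 : μ null = 0 := by
      have h : ∀ᵐ ω ∂μ, ‖u ω‖ = 1 ∧ ∀ i l, |V ω i l| ≤ D₁ :=
        hinit'.ae_norm_u.and (ae_all_iff.2 fun i => ae_all_iff.2 fun l => hinit'.bounded_V i l)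
      exact h
    obtain ⟨E, hE, hEμ, hEg⟩ := exists_measurableSet_of_measure_le (μ := μ)
      (bad := g ⁻¹' badM ∪ g ⁻¹' badN ∪ null) (a := 1 / n) (b := 1 / d)
      (by positivity) (by positivity) (by
        refine (measure_union_le _ _).trans ?_
        rw [hnull0, add_zero]
        exact (measure_union_le _ _).trans
          (add_le_add ((hpre _).trans hQM) ((hpre _).trans hQN)))
    refine ⟨E, hE, hEμ, fun ω hω Θ hΘ hσ hkk => ?_⟩
    have hω' := hEg ω hω
    simp only [Set.mem_union, not_or] at hω'
    obtain ⟨⟨hωM, hωN⟩, hω0⟩ := hω'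
    rw [hnull, Set.mem_ofPred_eq, not_not] at hω0
    refine initCondition_of_good hn hk hdiff hB0 hLip hD0 hF hL hC0.le hψ hr hγ0 hC'3 hω0.2 hω0.1
      (hnormN ω hωN) (fun x hx => ?_) hσ hkk
    by_contra hcon
    exact hωM ⟨x, hx, (not_le.1 hcon).le⟩
  -- With k < C₁ n log n, no Θ can meet the hypotheses once the output bound holds, so the
  -- conclusion is vacuous on that event.
  · have huniq := halt.resolve_right fun h => hwidth (le_trans (by gcongr) h)
    obtain ⟨E, hE, hEμ, hEg⟩ := exists_measurableSet_of_measure_le (μ := μ)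
      (bad := g ⁻¹' badN) (a := 1 / n) (b := 1 / d) (by positivity) (by positivity)
      (((hpre _).trans hQN).trans le_add_self)
    refine ⟨E, hE, hEμ, fun ω hω Θ hΘ hσ hkk => (hwidth ?_).elim⟩
    have h1 := width_lower_bound_of_unique hn hm hF hL hC0.le hC'0.le hψ hr huniq
      (hnormN ω (hEg ω hω)) hΘ hσ hkk
    refine le_trans ?_ h1
    have h2 : C₁ ≤ C' * (C ^ 2 * Real.log 2) := (div_le_iff₀ (by positivity)).1 hC'2
    have h3 : Real.log 2 ≤ Real.log d := Real.log_le_log two_pos (by exact_mod_cast hd2)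
    have h4 : Real.log n ≤ n := (Real.log_le_sub_one_of_pos hn0).trans (by linarith)
    calc C₁ * n * Real.log n ≤ C' * (C ^ 2 * Real.log d) * n * n := by
          gcongr
          exact h2.trans (by gcongr)
      _ = _ := by ring
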